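/- Conventions. Let $p$ be a prime, $n\ge 0$ and $G=\mathbb{F}_p^n$; identify the dual group with $\mathbb{F}_p^n$, letting $\gamma$ stand for the character $x\mapsto e^{2\pi i(\gamma\cdot x)/p}$. For $f,g:G\to\mathbb{C}$ put $\widehat f(\gamma)=\mathbb{E}_x f(x)e^{-2\pi i(\gamma\cdot x)/p}$, $f*g(x)=\mathbb{E}_y f(y)g(x-y)$, $f\circ g(x)=\mathbb{E}_y f(y)\overline{g(y-x)}$, $\|f\|_q=(\mathbb{E}_x|f(x)|^q)^{1/q}$ for $1\le q<\infty$ and $\|f\|_\infty=\max_x|f(x)|$, where $\mathbb{E}_x$ is the average over $x\in G$. For non-empty $S\subset G$ let $1_S$ be its indicator function, $|S|/|G|$ its density, and $\mu_S=\frac{|G|}{|S|}1_S$. For $A\subset G$ let $\Delta_\eta(A)=\{\gamma:|\widehat{1_A}(\gamma)|\ge\eta\|1_A\|_1\}$. For finite sets $X,H$ of frequencies, $E_{2m}(X)$ is the number of $(\gamma_1,\dots,\gamma_m,\gamma_1',\dots,\gamma_m')\in X^{2m}$ with $\gamma_1+\cdots+\gamma_m=\gamma_1'+\cdots+\gamma_m'$;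 $\langle 1_X\circ 1_X,1_H\circ 1_H\rangle=\sum_\gamma (1_X\circ 1_X)(\gamma)\,(1_H\circ 1_H)(\gamma)$ with, on the frequency side, $(1_S\circ 1_S)(\gamma)=\sum_\lambda 1_S(\lambda)1_S(\lambda-\gamma)$; and $\dim(H)$ is the size of the largest subset of $H$ that is linearly independent over $\mathbb{F}_p$. **Proposition.** There are absolute constants $C,C_1,C_2,C_3,C_4>0$ such that the following holds for every prime $p$ and every $n$. Let $A\subset\mathbb{F}_p^n$ be non-empty of density $\alpha$, let $\eta\in(0,1]$, and let $m$ be a positive integer with $m\ge C\log(2/\alpha\eta)$. Suppose that there are a non-empty set $X\subset\Delta_\eta(A)\setminus\{0\}$ and a set $H\subset\mathbb{F}_p^n$ such that, for some real $K\ge 2$, 1. $|H|\ge K^{-1}\eta^{-1}$, 2. $E_{2m}(X)\le (K\eta|X|)^{2m}$, 3. $\langle 1_X\circ 1_X,1_H\circ 1_H\rangle\ge K^{-1}|X||H|^2$, and 4. $\|\mu_A\circ\mu_A\|_{2m}\le K$. Then there is a subspace $W\le\mathbb{F}_p^n$ of codimension $$\mathrm{codim}(W)\le\dim(H)+C_1\Big(\log\frac{4K}{\alpha}\Big)^{C_2}K^{C_3}$$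 such that $$\|\mu_A*\mu_W\|_\infty\ge 1+K^{-C_4}.$$ -/

import Mathlib

open scoped BigOperators

noncomputable section

namespace SpectralBoosting

/-- Indicator function of a set, with real values. -/
def ind {G : Type*} (S : Set G) : G → ℝ := S.indicator 1

/-- The density `μ(S) = |S| / |G|` of a subset of a finite group. -/
def density {G : Type*} [Fintype G] (S : Set G) : ℝ :=
  (S.ncard : ℝ) / (Fintype.card G : ℝ)

/-- The normalised indicator function `μ_S = μ(S)⁻¹ 1_S`. -/
def mu {G : Type*} [Fintype G] (S : Set G) : G → ℝ :=
  fun x => (density S)⁻¹ * ind S x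

/-- Convolution on the physical side (compact normalisation):
`(f ∗ g)(x) = 𝔼_y f(y) g(x - y)`. -/
def conv {G : Type*} [AddCommGroup G] [Fintype G] (f g : G → ℝ) : G → ℝ :=
  fun x => 𝔼 y, f y * g (x - y)

/-- The operation `(f ∘ g)(x) = 𝔼_y f(y) g(y - x)` on the physical side; all functions it is used
for are real, so there is no complex conjugate. -/
def circ {G : Type*} [AddCommGroup G] [Fintype G] (f g : G → ℝ) : G → ℝ :=
  fun x => 𝔼 y, f y * g (y - x)

/-- The `L^q` norm on the physical side (compact normalisation), for `1 ≤ q < ∞`. -/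
def lpNorm {G : Type*} [Fintype G] (q : ℝ) (f : G → ℝ) : ℝ :=
  (𝔼 x, |f x| ^ q) ^ (1 / q)

/-- The `L^∞` norm. -/
def supNorm {G : Type*} (f : G → ℝ) : ℝ := ⨆ x, |f x|

/-- The operation `(ω ∘ ν)(γ) = ∑_λ ω(λ) ν(λ - γ)` on the frequency side
(discrete normalisation), for real functions. -/
def dualCirc {G : Type*} [AddCommGroup G] [Fintype G] (ω ν : G → ℝ) : G → ℝ :=
  fun γ => ∑ l, ω l * ν (l - γ)

/-- The inner product `⟨ω, ν⟩ = ∑_γ ω(γ) ν(γ)` on the frequency side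
(discrete normalisation), for real functions. -/
def dualInner {G : Type*} [Fintype G] (ω ν : G → ℝ) : ℝ := ∑ γ, ω γ * ν γ

/-- The `2m`-fold additive energy `E_{2m}(X)`: the number of
`(γ₁, …, γₘ, γ₁', …, γₘ') ∈ X^{2m}` with `γ₁ + ⋯ + γₘ = γ₁' + ⋯ + γₘ'`. -/
def energy {G : Type*} [AddCommGroup G] [DecidableEq G] (m : ℕ) (X : Finset G) : ℕ :=
  (((Fintype.piFinset fun _ : Fin m => X) ×ˢ (Fintype.piFinset fun _ : Fin m => X)).filter
    fun ab => ∑ i, ab.1 i = ∑ i, ab.2 i).card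

/-- The Fourier transform on `𝔽_p^n`: `f̂(γ) = 𝔼_x f(x) conj(γ(x))`, where the dual group is
identified with `𝔽_p^n` by letting `γ` stand for the character `x ↦ exp(2πi (γ ⬝ x) / p)`. -/
def fourier {p : ℕ} [NeZero p] {n : ℕ} (f : (Fin n → ZMod p) → ℝ) (γ : Fin n → ZMod p) : ℂ :=
  𝔼 x, (f x : ℂ) * (starRingEnd ℂ) (ZMod.stdAddChar (γ ⬝ᵥ x))

/-- The `η`-large spectrum `Δ_η(f) = {γ : |f̂(γ)| ≥ η ‖f‖₁}`. -/
def largeSpectrum {p : ℕ} [NeZero p] {n : ℕ} (η : ℝ) (f : (Fin n → ZMod p) → ℝ) :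
    Set (Fin n → ZMod p) :=
  {γ | η * lpNorm 1 f ≤ ‖fourier f γ‖}

open Classical in
/-- `dim H`: the size of the largest subset of `H` that is linearly independent over `𝔽_p`. -/
def linDim {p n : ℕ} (H : Finset (Fin n → ZMod p)) : ℕ :=
  (H.powerset.filter fun S : Finset (Fin n → ZMod p) =>
    LinearIndepOn (ZMod p) id (S : Set (Fin n → ZMod p))).sup Finset.card

end SpectralBoosting

end

/-! ### Jensen-type moment inequalities and a Marcinkiewicz–Zygmund bound. -/

namespace SpectralBoosting

open Finset

/-! Write `a` for `mu A`, `ν = |∑_{h∈H} χ_h|² / |H|` and `g = Re ∑_{γ∈X} χ_γ`. The weight `ν` is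
non-negative, has mean 1, is at most `|H|`, and is constant on cosets of the annihilator `perp H`.

Pairing `ν g` with the autocorrelation of `a` gives `|H|⁻¹ ∑_{h,h',γ} |â(h - h' + γ)|²`. Keeping
only the terms with `h - h' + γ ∈ X`, hypotheses 3 and 1 make this at least `K⁻² η |X|`. For
uncorrelated `a` the pairing would be `𝔼 ν g ≤ |H|`, and if `η ≤ 1/(4K⁵)` then `|H| ≤ K⁻² η |X| / 2`
(`exists_exponent`). The energy hypothesis bounds the `L^{2k}(ν)` norm of `g` by `2Kη|X|` for some
`k` of size `O(log(4K/α))`, so the excess is at least a constant times `K⁻³` times that norm.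

Since `ν` is constant on cosets of `perp H`, the excess survives on some pair of cosets
(`exists_correlated_cosets`). If no coset of `perp H` already carries a density increment, the two
pieces of `A` there have density nearly `α` and correlate with `g`. Croot–Sisask almost periodicity
with Chang's lemma (`exists_subspace_abs_expect_le`) allows both pieces to be averaged over a
subspace `V` of `perp H` of polylogarithmic relative codimension. Were all these averages at most `1
+ κ`, their correlation would be almost constantly 1 and no excess would remain
(`exists_increment_of_correlation`). So some translate of `V` carries an increment.

When `η > 1/(4K⁵)`, one non-zero frequency of `X` gives an increment on a hyperplane
(`exists_hyperplane_increment`). -/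

/-- Jensen's inequality for an even power with respect to an unnormalised weight. -/
lemma pow_expect_mul_le {ι : Type*} [Fintype ι] (w z : ι → ℝ) (hw : ∀ i, 0 ≤ w i) {k : ℕ}
    (hk : 1 ≤ k) :
    (𝔼 i, w i * z i) ^ (2 * k) ≤ (𝔼 i, w i) ^ (2 * k - 1) * 𝔼 i, w i * z i ^ (2 * k) := by
  have hW0 : 0 ≤ 𝔼 i, w i := expect_nonneg fun i _ => hw i
  rcases hW0.eq_or_lt with h0 | hpos
  · have hz : ∀ i, w i = 0 := by
      have := (Fintype.expect_eq_zero_iff_of_nonneg (f := w) hw).1 h0.symm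
      exact fun i => congrFun this i
    simp [hz, show k ≠ 0 by omega]
  · have hι : Nonempty ι := by
      by_contra h
      rw [not_nonempty_iff] at h
      simp [Finset.univ_eq_empty] at hpos
    have hc : (0 : ℝ) < Fintype.card ι := by exact_mod_cast Fintype.card_pos
    set W := 𝔼 i, w i with hWdef
    have hsum : ∑ i, w i = Fintype.card ι * W := by rw [hWdef, Fintype.card_mul_expect]
    have key := Real.pow_arith_mean_le_arith_mean_pow_of_even univ
      (fun i => w i / (Fintype.card ι * W)) z (fun i _ => div_nonneg (hw i) (by positivity))
      (by rw [← Finset.sum_div, hsum, div_self (by positivity)]) (even_two_mul k)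
    have e1 : ∀ u : ι → ℝ, ∑ i, w i / (Fintype.card ι * W) * u i = (𝔼 i, w i * u i) / W := by
      intro u
      rw [Fintype.expect_eq_sum_div_card, div_div, Finset.sum_div]
      exact Finset.sum_congr rfl fun i _ => by ring
    rw [e1, e1, div_pow, div_le_div_iff₀ (by positivity) hpos] at key
    have e2 : W ^ (2 * k) = W ^ (2 * k - 1) * W := by
      rw [← pow_succ]; congr 1; omega
    rw [e2] at key
    have : (𝔼 i, w i * z i) ^ (2 * k) * W
        ≤ (W ^ (2 * k - 1) * 𝔼 i, w i * z i ^ (2 * k)) * W := by linarith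
    exact le_of_mul_le_mul_right this hpos

lemma pow_expect_le {ι : Type*} [Fintype ι] [Nonempty ι] (z : ι → ℝ) {k : ℕ} (hk : 1 ≤ k) :
    (𝔼 i, z i) ^ (2 * k) ≤ 𝔼 i, z i ^ (2 * k) := by
  simpa [Fintype.expect_one] using pow_expect_mul_le (fun _ : ι => (1 : ℝ)) z (by simp) hk

lemma pow_expect_finset_le {ι : Type*} {s : Finset ι} (hs : s.Nonempty) (z : ι → ℝ) {k : ℕ} :
    (𝔼 i ∈ s, z i) ^ (2 * k) ≤ 𝔼 i ∈ s, z i ^ (2 * k) := by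
  have hc : (0 : ℝ) < #s := by exact_mod_cast hs.card_pos
  have key := Real.pow_arith_mean_le_arith_mean_pow_of_even s (fun _ => 1 / (#s : ℝ)) z
      (fun i _ => by positivity) (by simp [hc.ne']) (even_two_mul k)
  have e1 : ∀ u : ι → ℝ, ∑ i ∈ s, 1 / (#s : ℝ) * u i = 𝔼 i ∈ s, u i := by
    intro u
    rw [expect_eq_sum_div_card, Finset.sum_div]
    exact Finset.sum_congr rfl fun i _ => by ring
  rwa [e1, e1] at key

lemma pow_sum_range_le (l k : ℕ) (hk : 1 ≤ k) (z : ℕ → ℝ) :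
    (∑ i ∈ range l, z i) ^ (2 * k) ≤ (l : ℝ) ^ (2 * k - 1) * ∑ i ∈ range l, z i ^ (2 * k) := by
  rcases Nat.eq_zero_or_pos l with rfl | hl
  · simp [show k ≠ 0 by omega]
  have hl' : (0 : ℝ) < l := by exact_mod_cast hl
  have := pow_expect_finset_le (s := range l) (by simpa using hl.ne') z (k := k)
  rw [expect_eq_sum_div_card, expect_eq_sum_div_card, card_range, div_pow,
    div_le_div_iff₀ (by positivity) hl'] at this
  have e2 : (l : ℝ) ^ (2 * k) = l ^ (2 * k - 1) * l := by
    rw [← pow_succ]; congr 1; omega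
  rw [e2] at this
  refine le_of_mul_le_mul_right (this.trans (le_of_eq ?_)) hl'
  ring

lemma add_pow_even_le (a b : ℝ) {k : ℕ} (hk : 1 ≤ k) :
    (a + b) ^ (2 * k) ≤ 2 ^ (2 * k - 1) * (a ^ (2 * k) + b ^ (2 * k)) := by
  have := pow_sum_range_le 2 k hk (fun i => if i = 0 then a else b)
  simpa [Finset.sum_range_succ] using this

lemma abs_prod_le_expect_pow {n : ℕ} (hn : 0 < n) (z : Fin n → ℝ) :
    |∏ j, z j| ≤ (∑ j, |z j| ^ n) / n := by
  have hn' : (n : ℝ) ≠ 0 := by positivity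
  have key := Real.geom_mean_le_arith_mean_weighted univ (fun _ : Fin n => 1 / (n : ℝ))
    (fun j => |z j| ^ n) (fun _ _ => by positivity) (by simp [hn'])
    (fun _ _ => by positivity)
  have e : ∀ j, (|z j| ^ n) ^ (1 / (n : ℝ)) = |z j| := by
    intro j
    rw [one_div, Real.pow_rpow_inv_natCast (abs_nonneg _) hn.ne']
  simp only [e] at key
  rw [Finset.abs_prod, Finset.sum_div]
  refine key.trans (le_of_eq (Finset.sum_congr rfl fun j _ => by ring))

/-- Each attained value is attained at least twice, so the image has at most `k` points and `φ`
factors through `Fin k`: there are `k ^ (2k)` choices for the first factor and `q ^ k` for the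
second. -/
lemma card_no_singleton_fiber_le (k q : ℕ) :
    #{φ : Fin (2 * k) → Fin q | ∀ i, #{j | φ j = i} ≠ 1} ≤ q ^ k * k ^ (2 * k) := by
  classical
  have hsub : ({φ : Fin (2 * k) → Fin q | ∀ i, #{j | φ j = i} ≠ 1} : Finset _) ⊆
      (univ : Finset ((Fin k → Fin q) × (Fin (2 * k) → Fin k))).image
        (fun cd j => cd.1 (cd.2 j)) := by
    intro φ hφ
    simp only [mem_filter, mem_univ, true_and] at hφ
    have hcard : #(univ.image φ) * 2 ≤ 2 * k := by
      calc #(univ.image φ) * 2 ≤ ∑ i ∈ univ.image φ, #{j | φ j = i} := by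
            rw [← smul_eq_mul]
            refine Finset.card_nsmul_le_sum _ _ _ fun i hi => ?_
            have h1 := hφ i
            have h2 : 0 < #{j | φ j = i} := by
              obtain ⟨j, -, hj⟩ := mem_image.1 hi
              exact Finset.card_pos.2 ⟨j, by simp [hj]⟩
            omega
        _ = 2 * k := by
            rw [← Finset.card_eq_sum_card_image]; simp
    have hcard' : #(univ.image φ) ≤ k := by omega
    rcases Nat.eq_zero_or_pos k with rfl | hk
    · simp only [mem_image, mem_univ, true_and]
      exact ⟨(fun j => j.elim0, fun j => j.elim0), funext fun j => j.elim0⟩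
    have hne : (univ.image φ).Nonempty := ⟨φ ⟨0, by omega⟩, mem_image_of_mem _ (mem_univ _)⟩
    have i0 : Fin q := φ ⟨0, by omega⟩
    let e := (univ.image φ).equivFin
    simp only [mem_image, mem_univ, true_and]
    refine ⟨(fun t => if h : t.1 < #(univ.image φ) then (e.symm ⟨t.1, h⟩).1 else i0,
      fun j => ⟨(e ⟨φ j, mem_image_of_mem _ (mem_univ _)⟩).1, by
        exact lt_of_lt_of_le (Fin.is_lt _) hcard'⟩), ?_⟩
    funext j
    simp
  refine (card_le_card hsub).trans (card_image_le.trans ?_)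
  simp [Fintype.card_prod]

lemma expect_prod_pi {Ω : Type*} [Fintype Ω] [Nonempty Ω] (q : ℕ) (F : Fin q → Ω → ℝ) :
    𝔼 b : Fin q → Ω, ∏ i, F i (b i) = ∏ i, 𝔼 ω, F i ω := by
  rw [Fintype.expect_eq_sum_div_card]
  simp_rw [Fintype.expect_eq_sum_div_card]
  rw [Finset.prod_div_distrib, Finset.prod_univ_sum]
  simp

/-- A Marcinkiewicz–Zygmund type inequality for sums of independent copies of a centred variable. -/
lemma expect_sum_pow_le {Ω : Type*} [Fintype Ω] [Nonempty Ω] (q : ℕ) {k : ℕ} (hk : 1 ≤ k)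
    (Z : Ω → ℝ) (hZ : 𝔼 ω, Z ω = 0) :
    𝔼 b : Fin q → Ω, (∑ i, Z (b i)) ^ (2 * k) ≤
      (q : ℝ) ^ k * (k : ℝ) ^ (2 * k) * 𝔼 ω, Z ω ^ (2 * k) := by
  classical
  have hexp : ∀ b : Fin q → Ω, (∑ i, Z (b i)) ^ (2 * k) =
      ∑ φ : Fin (2 * k) → Fin q, ∏ j, Z (b (φ j)) := fun b => by
    rw [Finset.sum_pow']; simp
  simp_rw [hexp]
  rw [Finset.expect_sum_comm]
  have hN : 0 ≤ 𝔼 ω, Z ω ^ (2 * k) := expect_nonneg fun ω _ => (even_two_mul k).pow_nonneg _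
  have hfib : ∀ (φ : Fin (2 * k) → Fin q) (b : Fin q → Ω),
      ∏ j, Z (b (φ j)) = ∏ i, Z (b i) ^ #{j | φ j = i} := by
    intro φ b
    rw [← Finset.prod_fiberwise (s := univ) (g := φ)]
    refine Finset.prod_congr rfl fun i _ => ?_
    rw [← Finset.prod_const]
    refine Finset.prod_congr rfl fun j hj => ?_
    rw [(mem_filter.1 hj).2]
  -- A coordinate hit exactly once contributes, by independence, a factor `𝔼 Z = 0`.
  have hzero : ∀ φ : Fin (2 * k) → Fin q, ¬ (∀ i, #{j | φ j = i} ≠ 1) →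
      𝔼 b : Fin q → Ω, ∏ j, Z (b (φ j)) = 0 := by
    intro φ hφ
    push Not at hφ
    obtain ⟨i, hi⟩ := hφ
    simp_rw [hfib]
    rw [expect_prod_pi q (fun i ω => Z ω ^ #{j | φ j = i})]
    refine Finset.prod_eq_zero (mem_univ i) ?_
    simp [hi, hZ]
  have hmarg : ∀ i : Fin q, 𝔼 b : Fin q → Ω, |Z (b i)| ^ (2 * k) = 𝔼 ω, Z ω ^ (2 * k) := by
    intro i
    have := expect_prod_pi (Ω := Ω) q (fun i' ω => if i' = i then |Z ω| ^ (2 * k) else 1)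
    simp only [Finset.prod_ite_eq', mem_univ, if_true] at this
    rw [this, Finset.prod_eq_single i]
    · simp [(even_two_mul k).pow_abs]
    · intro j _ hj; simp [hj]
    · simp
  have hbd : ∀ φ : Fin (2 * k) → Fin q,
      𝔼 b : Fin q → Ω, ∏ j, Z (b (φ j)) ≤ 𝔼 ω, Z ω ^ (2 * k) := by
    intro φ
    calc 𝔼 b : Fin q → Ω, ∏ j, Z (b (φ j))
        ≤ 𝔼 b : Fin q → Ω, (∑ j, |Z (b (φ j))| ^ (2 * k)) / ((2 * k : ℕ) : ℝ) :=
          expect_le_expect fun b _ => (le_abs_self _).trans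
            (abs_prod_le_expect_pow (by omega) (fun j => Z (b (φ j))))
      _ = 𝔼 ω, Z ω ^ (2 * k) := by
          have hk0 : (k : ℝ) ≠ 0 := by positivity
          rw [← Finset.expect_div, Finset.expect_sum_comm]
          simp_rw [hmarg]
          simp only [sum_const, card_univ, Fintype.card_fin, nsmul_eq_mul]
          field_simp
  calc ∑ φ : Fin (2 * k) → Fin q, 𝔼 b : Fin q → Ω, ∏ j, Z (b (φ j))
      = ∑ φ : Fin (2 * k) → Fin q with (∀ i, #{j | φ j = i} ≠ 1),
          𝔼 b : Fin q → Ω, ∏ j, Z (b (φ j)) := by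
        rw [Finset.sum_filter]
        refine Finset.sum_congr rfl fun φ _ => ?_
        split_ifs with h
        · rfl
        · exact hzero φ h
    _ ≤ ∑ φ : Fin (2 * k) → Fin q with (∀ i, #{j | φ j = i} ≠ 1), 𝔼 ω, Z ω ^ (2 * k) :=
        Finset.sum_le_sum fun φ _ => hbd φ
    _ ≤ _ := by
        rw [sum_const, nsmul_eq_mul]
        refine mul_le_mul_of_nonneg_right ?_ hN
        exact_mod_cast card_no_singleton_fiber_le k q

end SpectralBoosting

/-! ### Croot–Sisask almost periodicity by random sampling. -/

namespace SpectralBoosting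

open Finset

lemma expect_add_right {G : Type*} [AddCommGroup G] [Fintype G] (f : G → ℝ) (t : G) :
    𝔼 x, f (x + t) = 𝔼 x, f x :=
  Fintype.expect_equiv (Equiv.addRight t) _ _ fun _ => rfl

lemma expect_sub_left {G : Type*} [AddCommGroup G] [Fintype G] (f : G → ℝ) (t : G) :
    𝔼 x, f (t - x) = 𝔼 x, f x :=
  Fintype.expect_equiv (Equiv.subLeft t) _ _ fun _ => rfl

/-- Markov's inequality in the form: at least half of the points are below twice the mean. -/
lemma card_le_two_mul_card_filter {Ω : Type*} [Fintype Ω] (F : Ω → ℝ) (hF : ∀ ω, 0 ≤ F ω) (R : ℝ)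
    (hR : 𝔼 ω, F ω ≤ R) :
    Fintype.card Ω ≤ 2 * #{ω | F ω ≤ 2 * R} := by
  classical
  have hR0 : 0 ≤ R := (expect_nonneg fun ω _ => hF ω).trans hR
  have hsum : ∑ ω, F ω ≤ Fintype.card Ω * R := by
    rw [← Fintype.card_mul_expect]; exact mul_le_mul_of_nonneg_left hR (by positivity)
  have hsplit : #{ω | F ω ≤ 2 * R} + #{ω | ¬ F ω ≤ 2 * R} = Fintype.card Ω := by
    rw [Finset.card_filter_add_card_filter_not, card_univ]
  by_contra! hlt
  have hbad : (#{ω | ¬ F ω ≤ 2 * R} : ℝ) * (2 * R) ≤ ∑ ω, F ω := by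
    rw [← nsmul_eq_mul]
    refine (Finset.card_nsmul_le_sum _ F _ fun ω hω => (not_le.1 (mem_filter.1 hω).2).le).trans ?_
    exact Finset.sum_le_sum_of_subset_of_nonneg (filter_subset _ _) fun ω _ _ => hF ω
  rcases hR0.eq_or_lt with h0 | hpos
  · have hzero : ∀ ω, F ω = 0 := by
      have h : ∑ ω, F ω = 0 := le_antisymm (by simpa [← h0] using hsum) (sum_nonneg fun ω _ => hF ω)
      exact fun ω => (Finset.sum_eq_zero_iff_of_nonneg fun ω _ => hF ω).1 h ω (mem_univ _)
    simp [hzero, ← h0] at hlt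
    omega
  · have h1 : (#{ω | ¬ F ω ≤ 2 * R} : ℝ) * (2 * R) ≤ Fintype.card Ω * R := hbad.trans hsum
    have h2 : (Fintype.card Ω : ℝ) < 2 * #{ω | ¬ F ω ≤ 2 * R} := by
      exact_mod_cast (by omega : Fintype.card Ω < 2 * #{ω | ¬ F ω ≤ 2 * R})
    nlinarith

variable {G : Type*} [AddCommGroup G] [Fintype G]

/-- The average of `g` over the reflected translates of `B`. -/
noncomputable def refAvg (B : Finset G) (g : G → ℝ) (y : G) : ℝ := 𝔼 b : B, g (b.1 - y)

lemma expect_expect_sub {B : Finset G} (hB : B.Nonempty) (F : G → ℝ) :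
    𝔼 y, 𝔼 b : B, F (b.1 - y) = 𝔼 x, F x := by
  have : Nonempty B := hB.to_subtype
  rw [Finset.expect_comm]
  simp_rw [expect_sub_left]
  exact Fintype.expect_const _

lemma moment_refAvg_le {B : Finset G} (hB : B.Nonempty) (g : G → ℝ) {k : ℕ} (hk : 1 ≤ k) :
    𝔼 y, refAvg B g y ^ (2 * k) ≤ 𝔼 x, g x ^ (2 * k) := by
  have : Nonempty B := hB.to_subtype
  rw [← expect_expect_sub hB (fun x => g x ^ (2 * k))]
  exact expect_le_expect fun y _ => pow_expect_le _ hk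

/-- Most samples from `B` approximate `refAvg B g` in the `2k`-th moment. -/
lemma half_le_card_good_samples {B : Finset G} (hB : B.Nonempty) (g : G → ℝ) {k : ℕ} (hk : 1 ≤ k)
    (q : ℕ) :
    #B ^ q ≤ 2 * #{b : Fin q → B | 𝔼 y, (∑ i, (g ((b i).1 - y) - refAvg B g y)) ^ (2 * k) ≤
      2 * ((q : ℝ) ^ k * (2 * k) ^ (2 * k) * 𝔼 x, g x ^ (2 * k))} := by
  have : Nonempty B := hB.to_subtype
  have h := card_le_two_mul_card_filter (Ω := Fin q → B)
    (fun b => 𝔼 y, (∑ i, (g ((b i).1 - y) - refAvg B g y)) ^ (2 * k))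
    (fun b => expect_nonneg fun y _ => (even_two_mul k).pow_nonneg _)
    ((q : ℝ) ^ k * (2 * k) ^ (2 * k) * 𝔼 x, g x ^ (2 * k)) ?_
  · simpa using h
  rw [Finset.expect_comm, ← expect_expect_sub hB (fun x => g x ^ (2 * k)), Finset.mul_expect]
  refine expect_le_expect fun y _ => ?_
  have h1 := expect_sum_pow_le q hk (fun b : B => g (b.1 - y) - refAvg B g y) (by
    rw [Finset.expect_sub_distrib, Fintype.expect_const, refAvg, sub_self])
  refine h1.trans ?_
  -- Centring costs `2 ^ (2k)`, which turns the `k ^ (2k)` of the moment bound into `(2k) ^ (2k)`.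
  have h2 : 𝔼 b : B, (g (b.1 - y) - refAvg B g y) ^ (2 * k) ≤
      2 ^ (2 * k) * 𝔼 b : B, g (b.1 - y) ^ (2 * k) := by
    calc 𝔼 b : B, (g (b.1 - y) - refAvg B g y) ^ (2 * k)
        ≤ 𝔼 b : B, 2 ^ (2 * k - 1) * (g (b.1 - y) ^ (2 * k) + refAvg B g y ^ (2 * k)) := by
          refine expect_le_expect fun b _ => ?_
          have := add_pow_even_le (g (b.1 - y)) (-refAvg B g y) hk
          rwa [← sub_eq_add_neg, (even_two_mul k).neg_pow] at this
      _ = 2 ^ (2 * k - 1) * (𝔼 b : B, g (b.1 - y) ^ (2 * k) + refAvg B g y ^ (2 * k)) := by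
          rw [← Finset.mul_expect, Finset.expect_add_distrib, Fintype.expect_const]
      _ ≤ 2 ^ (2 * k - 1) * (𝔼 b : B, g (b.1 - y) ^ (2 * k) + 𝔼 b : B, g (b.1 - y) ^ (2 * k)) := by
          gcongr
          exact pow_expect_le _ hk
      _ = _ := by
          rw [← two_mul, ← mul_assoc, ← pow_succ]
          congr 2; omega
  calc _ ≤ (q : ℝ) ^ k * (k : ℝ) ^ (2 * k) * (2 ^ (2 * k) * 𝔼 b : B, g (b.1 - y) ^ (2 * k)) := by
        gcongr
    _ = _ := by rw [mul_pow]; ring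

/-- Croot–Sisask almost periodicity for averages over a set `B`. -/
lemma exists_almost_periods {B : Finset G} (hB : B.Nonempty) (g : G → ℝ) {k : ℕ} (hk : 1 ≤ k)
    {q : ℕ} (hq : 1 ≤ q) {δ : ℝ} (hδq : 64 * (k : ℝ) ^ 2 ≤ δ ^ 2 * q) :
    ∃ T : Finset G, ((#B : ℝ) / Fintype.card G) ^ q / 2 ≤ (#T : ℝ) / Fintype.card G ∧
      ∀ t ∈ T, ∀ t' ∈ T, 𝔼 y, (refAvg B g y - refAvg B g (y + (t - t'))) ^ (2 * k) ≤
        δ ^ (2 * k) * 𝔼 x, g x ^ (2 * k) := by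
  classical
  set ψ := refAvg B g with hψ
  set N := 𝔼 x, g x ^ (2 * k) with hN
  have hN0 : 0 ≤ N := expect_nonneg fun x _ => (even_two_mul k).pow_nonneg _
  set R := (q : ℝ) ^ k * (2 * k) ^ (2 * k) * N with hR
  let L : Finset (Fin q → G) := (univ.filter fun b : Fin q → B =>
    𝔼 y, (∑ i, (g ((b i).1 - y) - ψ y)) ^ (2 * k) ≤ 2 * R).image fun b i => (b i).1
  have hLcard : #B ^ q ≤ 2 * #L := by
    rw [card_image_of_injective _ (fun b b' h => funext fun i => Subtype.ext (congrFun h i))]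
    exact half_le_card_good_samples hB g hk q
  have hLgood : ∀ b ∈ L, 𝔼 y, (∑ i, (g (b i - y) - ψ y)) ^ (2 * k) ≤ 2 * R := by
    intro b hb
    obtain ⟨b', hb', rfl⟩ := mem_image.1 hb
    exact (mem_filter.1 hb').2
  -- Shifts of a fixed tuple `u` along the diagonal that land among the good samples. Each good
  -- sample lies on `|G|` such diagonals, so some `u` has many shifts.
  let T : (Fin q → G) → Finset G := fun u => univ.filter fun t => (fun i => u i - t) ∈ L
  have hcount : ∑ u, #(T u) = Fintype.card G * #L := by
    simp only [T, Finset.card_filter]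
    rw [Finset.sum_comm]
    have : ∀ t : G, ∑ u : Fin q → G, (if (fun i => u i - t) ∈ L then 1 else 0) = #L := by
      intro t
      rw [← Finset.card_filter]
      refine Finset.card_bij' (fun u _ i => u i - t) (fun b _ i => b i + t) ?_ ?_ ?_ ?_
      · intro u hu; exact (mem_filter.1 hu).2
      · intro b hb; simpa using hb
      · intro u _; funext i; simp
      · intro b _; funext i; simp
    simp [this]
  have hG : (0 : ℝ) < Fintype.card G := by exact_mod_cast Fintype.card_pos
  obtain ⟨u, hu⟩ : ∃ u, (Fintype.card G : ℝ) * #L / (Fintype.card G : ℝ) ^ q ≤ #(T u) := by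
    have h := Finset.exists_le_of_sum_le (s := (univ : Finset (Fin q → G)))
      (f := fun _ => (Fintype.card G : ℝ) * #L / (Fintype.card G : ℝ) ^ q)
      (g := fun u => (#(T u) : ℝ)) univ_nonempty (by
        rw [sum_const, card_univ, nsmul_eq_mul, Fintype.card_fun, Fintype.card_fin]
        push_cast
        rw [mul_div_cancel₀ _ (by positivity)]
        exact_mod_cast hcount.ge)
    obtain ⟨u, -, hu⟩ := h
    exact ⟨u, hu⟩
  refine ⟨T u, ?_, ?_⟩
  · rw [le_div_iff₀ hG, div_pow]
    refine le_trans ?_ hu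
    have : (#B : ℝ) ^ q ≤ 2 * #L := by exact_mod_cast hLcard
    have h3 : (0 : ℝ) < (Fintype.card G : ℝ) ^ q := by positivity
    calc _ = Fintype.card G * ((#B : ℝ) ^ q / 2) / (Fintype.card G : ℝ) ^ q := by ring
      _ ≤ _ := by gcongr; linarith
  -- The single tuple `u` approximates `ψ(· - t)` for every `t ∈ T u`, so any two of these
  -- translates are close to each other.
  · have hshift : ∀ t ∈ T u, 𝔼 y, (∑ i, g (u i - y) - q * ψ (y - t)) ^ (2 * k) ≤ 2 * R := by
      intro t ht
      have h := hLgood _ (mem_filter.1 ht).2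
      rw [← expect_add_right _ (-t)] at h
      refine le_trans (le_of_eq (Finset.expect_congr rfl fun y _ => ?_)) h
      congr 1
      rw [Finset.sum_sub_distrib, sum_const, card_univ, Fintype.card_fin, nsmul_eq_mul,
        ← sub_eq_add_neg]
      congr 1
      exact Finset.sum_congr rfl fun i _ => by congr 1; abel
    intro t ht t' ht'
    have hq0 : (0 : ℝ) < q := by exact_mod_cast hq
    have h1 : (q : ℝ) ^ (2 * k) * 𝔼 y, (ψ y - ψ (y + (t - t'))) ^ (2 * k) ≤
        2 ^ (2 * k) * (2 * R) := by
      rw [Finset.mul_expect, ← expect_add_right _ (-t)]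
      calc _ ≤ 𝔼 y, 2 ^ (2 * k - 1) * ((∑ i, g (u i - y) - q * ψ (y - t')) ^ (2 * k) +
            (∑ i, g (u i - y) - q * ψ (y - t)) ^ (2 * k)) := by
            refine expect_le_expect fun y _ => ?_
            have := add_pow_even_le (∑ i, g (u i - y) - q * ψ (y - t'))
              (-(∑ i, g (u i - y) - q * ψ (y - t))) hk
            rw [(even_two_mul k).neg_pow] at this
            refine le_trans (le_of_eq ?_) this
            rw [← mul_pow, show y + -t + (t - t') = y - t' by abel, show y + -t = y - t by abel]
            congr 1; ring
        _ = 2 ^ (2 * k - 1) * (𝔼 y, (∑ i, g (u i - y) - q * ψ (y - t')) ^ (2 * k) +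
            𝔼 y, (∑ i, g (u i - y) - q * ψ (y - t)) ^ (2 * k)) := by
            rw [← Finset.mul_expect, Finset.expect_add_distrib]
        _ ≤ 2 ^ (2 * k - 1) * (2 * R + 2 * R) := by
            gcongr
            · exact hshift t' ht'
            · exact hshift t ht
        _ = _ := by
            rw [← two_mul, ← mul_assoc, ← pow_succ]; congr 2; omega
    -- The 64 is a product of three fours: from the triangle inequality, from `2 ≤ 4 ^ k`, and from
    -- `(2k) ^ (2k) = 4 ^ k * k ^ (2k)`.
    have h2 : 2 ^ (2 * k) * (2 * R) ≤ (q : ℝ) ^ (2 * k) * (δ ^ (2 * k) * N) := by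
      have h3 : (2 : ℝ) ≤ 4 ^ k := by
        calc (2 : ℝ) ≤ 4 ^ 1 := by norm_num
          _ ≤ 4 ^ k := pow_le_pow_right₀ (by norm_num) hk
      calc (2 : ℝ) ^ (2 * k) * (2 * R) ≤ 2 ^ (2 * k) * (4 ^ k * R) := by
            gcongr
        _ = (q * (64 * (k : ℝ) ^ 2)) ^ k * N := by
            rw [hR]
            simp only [mul_pow, ← pow_mul]
            rw [show (64 : ℝ) ^ k = 2 ^ (2 * k) * 4 ^ k * 2 ^ (2 * k) by
              rw [pow_mul]; simp only [← mul_pow]; norm_num]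
            ring
        _ ≤ (q * (δ ^ 2 * q)) ^ k * N := by gcongr
        _ = _ := by
            simp only [pow_mul, mul_pow]; ring
    have h4 := h1.trans h2
    exact le_of_mul_le_mul_left h4 (by positivity)

end SpectralBoosting

/-! ### Chang's lemma by Riesz products, and Parseval. -/

namespace SpectralBoosting

open Finset
open scoped ComplexConjugate

lemma re_expect {ι : Type*} (s : Finset ι) (f : ι → ℂ) :
    (𝔼 i ∈ s, f i).re = 𝔼 i ∈ s, (f i).re := by
  rw [expect_eq_sum_div_card, expect_eq_sum_div_card, Complex.div_natCast_re, Complex.re_sum]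

/-- The exponential lies below its chord over `[-l, l]`. This makes an exponential of a character
sum into a product that is affine in each character. -/
lemma exp_mul_le_cosh_add (l x : ℝ) (h1 : -1 ≤ x) (h2 : x ≤ 1) :
    Real.exp (l * x) ≤ Real.cosh l + x * Real.sinh l := by
  have h := convexOn_exp.2 (Set.mem_univ l) (Set.mem_univ (-l))
    (show 0 ≤ (1 + x) / 2 by linarith) (show 0 ≤ (1 - x) / 2 by linarith) (by ring)
  simp only [smul_eq_mul] at h
  rw [show (1 + x) / 2 * l + (1 - x) / 2 * -l = l * x by ring] at h
  rw [Real.cosh_eq, Real.sinh_eq]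
  refine h.trans (le_of_eq (by ring))

variable {G : Type*} [AddCommGroup G] [Fintype G]

/-- The Fourier coefficient of the uniform measure on `T`. -/
noncomputable def unifCoeff (T : Finset G) (ψ : AddChar G ℂ) : ℂ := 𝔼 t : T, ψ t.1

lemma norm_unifCoeff_le {T : Finset G} (hT : T.Nonempty) (ψ : AddChar G ℂ) :
    ‖unifCoeff T ψ‖ ≤ 1 := by
  have : Nonempty T := hT.to_subtype
  refine (RCLike.norm_expect_le (K := ℂ)).trans ?_
  simp only [AddChar.norm_apply]
  exact (Fintype.expect_const (1 : ℝ)).le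

lemma expect_subtype_le (T : Finset G) (F : G → ℝ) (hF : ∀ x, 0 ≤ F x) :
    (#T : ℝ) / Fintype.card G * 𝔼 t : T, F t.1 ≤ 𝔼 x, F x := by
  rcases T.eq_empty_or_nonempty with rfl | hT
  · simpa using expect_nonneg fun x _ => hF x
  have h0 : (0 : ℝ) < #T := by exact_mod_cast hT.card_pos
  rw [Fintype.expect_eq_sum_div_card, Fintype.expect_eq_sum_div_card, Fintype.card_coe,
    div_mul_div_comm, mul_comm, mul_div_mul_right _ _ h0.ne']
  refine div_le_div_of_nonneg_right ?_ (by positivity)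
  rw [Finset.sum_coe_sort T F]
  exact Finset.sum_le_sum_of_subset_of_nonneg (subset_univ _) fun x _ _ => hF x

/-- Chang's lemma for dissociated sets of characters. -/
lemma card_le_of_addDissociated {T : Finset G} (hT : T.Nonempty) (Λ : Finset (AddChar G ℂ))
    (hΛ : AddDissociated (Λ : Set (AddChar G ℂ))) (hspec : ∀ ψ ∈ Λ, 1 / 2 ≤ ‖unifCoeff T ψ‖) :
    (#Λ : ℝ) ≤ 8 * Real.log (Fintype.card G / #T) := by
  classical
  have : Nonempty T := hT.to_subtype
  have hT0 : (0 : ℝ) < #T := by exact_mod_cast hT.card_pos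
  have hG0 : (0 : ℝ) < Fintype.card G := by exact_mod_cast Fintype.card_pos
  have hph : ∀ z : ℂ, ∃ c : ℂ, ‖c‖ ≤ 1 ∧ c * z = ‖z‖ := by
    intro z
    rcases eq_or_ne z 0 with rfl | hz
    · exact ⟨0, by simp⟩
    · have : (‖z‖ : ℂ) ≠ 0 := by simpa using hz
      refine ⟨conj z / ‖z‖, by simp [hz], ?_⟩
      rw [div_mul_eq_mul_div, mul_comm, Complex.mul_conj, Complex.normSq_eq_norm_sq]
      push_cast
      field_simp
  choose c hc1 hc2 using fun ψ : AddChar G ℂ => hph (unifCoeff T ψ)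
  -- On `T` the mean of `S` is at least `|Λ|/4`, while dissociativity gives `𝔼 exp S ≤ exp(|Λ|/8)`
  -- on the whole group; the density of `T` must pay for the gap. The scale `λ = 1/2` maximises `λ/2
  -- - λ²/2`.
  let S : G → ℝ := fun a => ∑ ψ ∈ Λ, 1 / 2 * (c ψ * ψ a).re
  have hS : 𝔼 t : T, S t.1 = ∑ ψ ∈ Λ, 1 / 2 * ‖unifCoeff T ψ‖ := by
    simp only [S]
    rw [Finset.expect_sum_comm]
    refine Finset.sum_congr rfl fun ψ _ => ?_
    rw [← Finset.mul_expect]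
    congr 1
    rw [← re_expect, ← Finset.mul_expect, ← unifCoeff, hc2, Complex.ofReal_re]
  have hexpS : 𝔼 a, Real.exp (S a) ≤ Real.exp ((#Λ : ℝ) / 8) := by
    -- Expanding the Riesz product, dissociativity leaves only the constant term.
    have hrand := AddDissociated.randomisation (fun ψ => if ψ ∈ Λ then Real.cosh (1 / 2) else 1)
      (fun ψ => if ψ ∈ Λ then (Real.sinh (1 / 2) : ℂ) * c ψ else 0)
      (hΛ.subset fun ψ hψ => by
        by_contra h
        exact hψ (if_neg h))
    calc 𝔼 a, Real.exp (S a)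
        ≤ 𝔼 a, ∏ ψ, ((if ψ ∈ Λ then Real.cosh (1 / 2) else 1) +
            ((if ψ ∈ Λ then (Real.sinh (1 / 2) : ℂ) * c ψ else 0) * ψ a).re) := by
          refine expect_le_expect fun a _ => ?_
          simp only [S]
          rw [Real.exp_sum, ← Finset.prod_subset (subset_univ Λ)
            (fun ψ _ hψ => by simp [hψ])]
          refine Finset.prod_le_prod (fun _ _ => (Real.exp_pos _).le) fun ψ hψ => ?_
          have hn : |(c ψ * ψ a).re| ≤ 1 := by
            refine (Complex.abs_re_le_norm _).trans ?_
            rw [norm_mul, AddChar.norm_apply, mul_one]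
            exact hc1 ψ
          have := exp_mul_le_cosh_add (1 / 2) _ (abs_le.1 hn).1 (abs_le.1 hn).2
          refine this.trans (le_of_eq ?_)
          rw [if_pos hψ, if_pos hψ, mul_assoc, Complex.re_ofReal_mul, mul_comm (Real.sinh _)]
      _ = Real.cosh (1 / 2) ^ #Λ := by
          rw [hrand, Finset.prod_ite_mem, univ_inter, prod_const]
      _ ≤ Real.exp ((1 / 2) ^ 2 / 2) ^ #Λ := by
          gcongr
          exact Real.cosh_le_exp_half_sq _
      _ = Real.exp ((#Λ : ℝ) / 8) := by
          rw [← Real.exp_nat_mul]; congr 1; ring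
  have hJ : Real.exp (𝔼 t : T, S t.1) ≤ 𝔼 t : T, Real.exp (S t.1) := by
    have h := convexOn_exp.map_sum_le (t := (univ : Finset T)) (w := fun _ => 1 / (#T : ℝ))
      (p := fun t => S t.1) (fun _ _ => by positivity) (by simp [hT0.ne'])
      (fun _ _ => Set.mem_univ _)
    simp only [smul_eq_mul, ← Finset.mul_sum] at h
    rw [Fintype.expect_eq_sum_div_card, Fintype.expect_eq_sum_div_card, Fintype.card_coe]
    refine le_trans (le_of_eq ?_) (h.trans (le_of_eq ?_))
    · congr 1; ring
    · ring
  have hmain : (#T : ℝ) / Fintype.card G * Real.exp ((#Λ : ℝ) / 4) ≤ Real.exp ((#Λ : ℝ) / 8) := by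
    refine le_trans ?_ ((expect_subtype_le T (fun a => Real.exp (S a))
      fun a => (Real.exp_pos _).le).trans hexpS)
    gcongr
    refine le_trans ?_ hJ
    rw [Real.exp_le_exp, hS]
    calc (#Λ : ℝ) / 4 = ∑ ψ ∈ Λ, 1 / 4 := by simp; ring
      _ ≤ _ := Finset.sum_le_sum fun ψ hψ => by linarith [hspec ψ hψ]
  have h2 : Real.exp ((#Λ : ℝ) / 8) ≤ Fintype.card G / #T := by
    rw [show (#Λ : ℝ) / 4 = #Λ / 8 + #Λ / 8 by ring, Real.exp_add, ← mul_assoc] at hmain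
    have h3 := le_of_mul_le_mul_right (by linarith : (#T : ℝ) / Fintype.card G *
      Real.exp ((#Λ : ℝ) / 8) * Real.exp ((#Λ : ℝ) / 8) ≤ 1 * Real.exp ((#Λ : ℝ) / 8))
      (Real.exp_pos _)
    rw [le_div_iff₀ hT0]
    rw [div_mul_eq_mul_div, div_le_one hG0] at h3
    linarith
  have h4 := (Real.le_log_iff_exp_le (by positivity)).2 h2
  linarith

/-- The Fourier coefficient of a real function at a character. -/
noncomputable def coeff (F : G → ℝ) (ψ : AddChar G ℂ) : ℂ := 𝔼 x, (F x : ℂ) * ψ x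

lemma expect_sq_eq_sum_normSq_coeff (F : G → ℝ) :
    𝔼 x, F x ^ 2 = ∑ ψ, ‖coeff F ψ‖ ^ 2 := by
  classical
  have hG0 : (Fintype.card G : ℂ) ≠ 0 := by exact_mod_cast Fintype.card_ne_zero
  have hG : Nonempty G := ⟨0⟩
  apply Complex.ofReal_injective
  push_cast
  have h : ∀ ψ : AddChar G ℂ, ((‖coeff F ψ‖ : ℂ)) ^ 2 =
      𝔼 x, 𝔼 y, (F x : ℂ) * F y * ψ (x - y) := by
    intro ψ
    rw [← Complex.mul_conj', coeff, map_expect, Finset.expect_mul_expect]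
    refine Finset.expect_congr rfl fun x _ => Finset.expect_congr rfl fun y _ => ?_
    rw [map_mul, Complex.conj_ofReal, sub_eq_add_neg, AddChar.map_add_eq_mul,
      AddChar.map_neg_eq_conj]
    ring
  simp_rw [h]
  rw [← Finset.expect_sum_comm]
  refine Finset.expect_congr rfl fun x _ => ?_
  rw [← Finset.expect_sum_comm]
  simp_rw [← Finset.mul_sum, AddChar.sum_apply_eq_ite, sub_eq_zero]
  rw [Fintype.expect_eq_sum_div_card]
  simp
  field_simp

end SpectralBoosting

/-! ### Smoothing over a subspace by iterated averaging. -/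

namespace SpectralBoosting

open Finset
open scoped ComplexConjugate

/-- Jensen's inequality for a power of a nonnegative function with an unnormalised weight. -/
lemma pow_expect_mul_le_of_nonneg {ι : Type*} [Fintype ι] (w z : ι → ℝ) (hw : ∀ i, 0 ≤ w i)
    (hz : ∀ i, 0 ≤ z i) {k : ℕ} (hk : 1 ≤ k) :
    (𝔼 i, w i * z i) ^ k ≤ (𝔼 i, w i) ^ (k - 1) * 𝔼 i, w i * z i ^ k := by
  have hk' : (1 : ℝ) ≤ k := by exact_mod_cast hk
  rcases isEmpty_or_nonempty ι with h | h
  · simp [Finset.univ_eq_empty, show k ≠ 0 by omega]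
  have h0 : (0 : ℝ) < Fintype.card ι := by exact_mod_cast Fintype.card_pos
  have hW0 : 0 ≤ 𝔼 i, w i := expect_nonneg fun i _ => hw i
  have hS0 : 0 ≤ 𝔼 i, w i * z i ^ k :=
    expect_nonneg fun i _ => mul_nonneg (hw i) (pow_nonneg (hz i) _)
  have key := Real.compact_inner_le_weight_mul_Lp_of_nonneg univ hk' (w := w) (f := z)
    hw hz
  simp only [Real.rpow_natCast] at key
  have key2 := pow_le_pow_left₀ (expect_nonneg fun i _ => mul_nonneg (hw i) (hz i)) key k
  refine key2.trans (le_of_eq ?_)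
  rw [mul_pow, ← Real.rpow_natCast _ k, ← Real.rpow_natCast (_ ^ ((k : ℝ)⁻¹)) k,
    ← Real.rpow_mul hW0, ← Real.rpow_mul hS0, inv_mul_cancel₀ (by positivity), Real.rpow_one,
    ← Real.rpow_natCast _ (k - 1)]
  congr 2
  rw [Nat.cast_sub hk, sub_mul, inv_mul_cancel₀ (by positivity)]
  simp

variable {G : Type*} [AddCommGroup G]

/-- Averaging over differences of elements of `T`. -/
noncomputable def symAvg (T : Finset G) (F : G → ℝ) (y : G) : ℝ :=
  𝔼 s : T × T, F (y + (s.1.1 - s.2.1))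

/-- Averaging over translates by elements of `V`. -/
noncomputable def finAvg (V : Finset G) (F : G → ℝ) (y : G) : ℝ := 𝔼 v : V, F (y + v.1)

lemma symAvg_sub (T : Finset G) (F F' : G → ℝ) :
    symAvg T (F - F') = symAvg T F - symAvg T F' := by
  funext y
  simp only [symAvg, Pi.sub_apply, Finset.expect_sub_distrib]

variable [Fintype G]

lemma coeff_translate (F : G → ℝ) (t : G) (ψ : AddChar G ℂ) :
    coeff (fun y => F (y + t)) ψ = conj (ψ t) * coeff F ψ := by
  rw [coeff, coeff, Finset.mul_expect]
  refine Fintype.expect_equiv (Equiv.addRight t) _ _ fun x => ?_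
  simp only [Equiv.coe_addRight]
  rw [← AddChar.map_neg_eq_conj, mul_left_comm, ← AddChar.map_add_eq_mul]
  congr 2
  abel

lemma coeff_expect {ι : Type*} [Fintype ι] (F : ι → G → ℝ) (ψ : AddChar G ℂ) :
    coeff (fun y => 𝔼 i, F i y) ψ = 𝔼 i, coeff (F i) ψ := by
  simp only [coeff]
  rw [Finset.expect_comm]
  refine Finset.expect_congr rfl fun x _ => ?_
  rw [← Finset.expect_mul]
  congr 1
  rw [Fintype.expect_eq_sum_div_card, Fintype.expect_eq_sum_div_card]
  push_cast
  rfl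

lemma coeff_sub (F F' : G → ℝ) (ψ : AddChar G ℂ) :
    coeff (fun y => F y - F' y) ψ = coeff F ψ - coeff F' ψ := by
  simp only [coeff, ← Finset.expect_sub_distrib]
  exact Finset.expect_congr rfl fun x _ => by push_cast; ring

lemma coeff_symAvg (T : Finset G) (F : G → ℝ) (ψ : AddChar G ℂ) :
    coeff (symAvg T F) ψ = (‖unifCoeff T ψ‖ : ℂ) ^ 2 * coeff F ψ := by
  have : symAvg T F = fun y => 𝔼 s : T × T, F (y + (s.1.1 - s.2.1)) := rfl
  rw [this, coeff_expect (fun (s : T × T) y => F (y + (s.1.1 - s.2.1)))]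
  simp_rw [coeff_translate]
  rw [← Finset.expect_mul, ← Complex.conj_mul', unifCoeff, map_expect, Finset.expect_mul_expect]
  congr 1
  rw [← Finset.univ_product_univ, Finset.expect_product]
  refine Finset.expect_congr rfl fun s _ => Finset.expect_congr rfl fun t _ => ?_
  rw [sub_eq_add_neg, AddChar.map_add_eq_mul, AddChar.map_neg_eq_conj, map_mul, Complex.conj_conj]

lemma coeff_iterate_symAvg (T : Finset G) (F : G → ℝ) (ψ : AddChar G ℂ) (l : ℕ) :
    coeff ((symAvg T)^[l] F) ψ = ((‖unifCoeff T ψ‖ : ℂ) ^ 2) ^ l * coeff F ψ := by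
  induction l with
  | zero => simp
  | succ l ih => rw [Function.iterate_succ_apply', coeff_symAvg, ih]; ring

lemma coeff_finAvg (V : Finset G) (F : G → ℝ) (ψ : AddChar G ℂ) :
    coeff (finAvg V F) ψ = conj (unifCoeff V ψ) * coeff F ψ := by
  have : finAvg V F = fun y => 𝔼 v : V, F (y + v.1) := rfl
  rw [this, coeff_expect (fun (v : V) y => F (y + v.1))]
  simp_rw [coeff_translate]
  rw [← Finset.expect_mul, unifCoeff, map_expect]

/-- By Parseval. Where `T` has a coefficient above 1/2, `V` is annihilated and averaging over it
changes nothing. Elsewhere `l` averagings over `T - T` damp the coefficient by `4 ^ (-l)`, and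
subtracting the `V`-average at most doubles it. -/
lemma expect_sq_sub_finAvg_le {T V : Finset G} (hV : V.Nonempty)
    (hTV : ∀ v ∈ V, ∀ ψ : AddChar G ℂ, 1 / 2 < ‖unifCoeff T ψ‖ → ψ v = 1) (F : G → ℝ) (l : ℕ) :
    𝔼 y, ((symAvg T)^[l] F y - finAvg V ((symAvg T)^[l] F) y) ^ 2 ≤
      4 * (1 / 16) ^ l * 𝔼 y, F y ^ 2 := by
  have hVn : Nonempty V := hV.to_subtype
  rw [expect_sq_eq_sum_normSq_coeff (fun y => (symAvg T)^[l] F y - finAvg V ((symAvg T)^[l] F) y),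
    expect_sq_eq_sum_normSq_coeff F, Finset.mul_sum]
  refine Finset.sum_le_sum fun ψ _ => ?_
  rw [coeff_sub, coeff_finAvg]
  rcases lt_or_ge (1 / 2) ‖unifCoeff T ψ‖ with h | h
  · have : unifCoeff V ψ = 1 := by
      rw [unifCoeff, Finset.expect_congr rfl (fun v _ => hTV v.1 v.2 ψ h)]
      exact Fintype.expect_const _
    rw [this]
    simp only [map_one, one_mul, sub_self, norm_zero, ne_eq, OfNat.ofNat_ne_zero,
      not_false_eq_true, zero_pow]
    positivity
  · have h1 : ‖(1 : ℂ) - conj (unifCoeff V ψ)‖ ≤ 2 := by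
      refine (norm_sub_le _ _).trans ?_
      rw [norm_one, Complex.norm_conj]
      linarith [norm_unifCoeff_le hV ψ]
    rw [← one_sub_mul, coeff_iterate_symAvg, norm_mul, norm_mul, norm_pow, norm_pow,
      Complex.norm_real, norm_norm]
    calc (‖1 - conj (unifCoeff V ψ)‖ * ((‖unifCoeff T ψ‖ ^ 2) ^ l * ‖coeff F ψ‖)) ^ 2
        ≤ (2 * (((1 / 2) ^ 2) ^ l * ‖coeff F ψ‖)) ^ 2 := by gcongr
      _ = _ := by
        rw [mul_pow, mul_pow, ← pow_mul ((1 / 2 : ℝ) ^ 2) l 2, mul_comm l 2, pow_mul]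
        norm_num
        ring

lemma moment_symAvg_le {T : Finset G} (hT : T.Nonempty) (F : G → ℝ) {k : ℕ} (hk : 1 ≤ k) :
    𝔼 y, symAvg T F y ^ (2 * k) ≤ 𝔼 y, F y ^ (2 * k) := by
  have : Nonempty T := hT.to_subtype
  calc 𝔼 y, symAvg T F y ^ (2 * k)
      ≤ 𝔼 y, 𝔼 s : T × T, F (y + (s.1.1 - s.2.1)) ^ (2 * k) :=
        expect_le_expect fun y _ => pow_expect_le _ hk
    _ = _ := by
        rw [Finset.expect_comm]
        simp_rw [expect_add_right (fun y => F y ^ (2 * k))]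
        exact Fintype.expect_const _

/-- Averaging over `T - T` contracts the moment, so every consecutive difference is controlled by
the first, which is an average of almost-period errors. -/
lemma moment_iterate_sub_le {T : Finset G} (hT : T.Nonempty) (F : G → ℝ) {k : ℕ} (hk : 1 ≤ k)
    {D : ℝ} (hD : ∀ t ∈ T, ∀ t' ∈ T, 𝔼 y, (F y - F (y + (t - t'))) ^ (2 * k) ≤ D) (i : ℕ) :
    𝔼 y, ((symAvg T)^[i] F y - (symAvg T)^[i + 1] F y) ^ (2 * k) ≤ D := by
  have hTn : Nonempty T := hT.to_subtype
  have hstep : ∀ i, ((symAvg T)^[i + 1] F - (symAvg T)^[i + 2] F) =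
      symAvg T ((symAvg T)^[i] F - (symAvg T)^[i + 1] F) := by
    intro i
    rw [symAvg_sub, ← Function.iterate_succ_apply' (symAvg T), ← Function.iterate_succ_apply' (symAvg T)]
  induction i with
  | zero =>
    simp only [Function.iterate_zero, id_eq, zero_add, Function.iterate_one]
    calc 𝔼 y, (F y - symAvg T F y) ^ (2 * k)
        ≤ 𝔼 y, 𝔼 s : T × T, (F y - F (y + (s.1.1 - s.2.1))) ^ (2 * k) := by
          refine expect_le_expect fun y _ => le_trans (le_of_eq ?_) (pow_expect_le _ hk)
          rw [Finset.expect_sub_distrib, Fintype.expect_const, symAvg]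
      _ ≤ D := by
          rw [Finset.expect_comm]
          exact expect_le univ_nonempty fun s _ => hD _ s.1.2 _ s.2.2
  | succ i ih =>
    have := moment_symAvg_le hT ((symAvg T)^[i] F - (symAvg T)^[i + 1] F) hk
    rw [← hstep] at this
    exact this.trans ih

lemma moment_sub_iterate_le {T : Finset G} (hT : T.Nonempty) (F : G → ℝ) {k : ℕ} (hk : 1 ≤ k)
    {D : ℝ} (hD : ∀ t ∈ T, ∀ t' ∈ T, 𝔼 y, (F y - F (y + (t - t'))) ^ (2 * k) ≤ D) (l : ℕ) :
    𝔼 y, (F y - (symAvg T)^[l] F y) ^ (2 * k) ≤ (l : ℝ) ^ (2 * k) * D := by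
  calc 𝔼 y, (F y - (symAvg T)^[l] F y) ^ (2 * k)
      ≤ 𝔼 y, (l : ℝ) ^ (2 * k - 1) *
          ∑ i ∈ range l, ((symAvg T)^[i] F y - (symAvg T)^[i + 1] F y) ^ (2 * k) := by
        refine expect_le_expect fun y _ => ?_
        refine le_trans (le_of_eq ?_) (pow_sum_range_le l k hk _)
        rw [Finset.sum_range_sub' (fun i => (symAvg T)^[i] F y)]
        simp
    _ = (l : ℝ) ^ (2 * k - 1) *
          ∑ i ∈ range l, 𝔼 y, ((symAvg T)^[i] F y - (symAvg T)^[i + 1] F y) ^ (2 * k) := by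
        rw [← Finset.mul_expect, Finset.expect_sum_comm]
    _ ≤ (l : ℝ) ^ (2 * k - 1) * ∑ i ∈ range l, D := by
        gcongr with i _
        exact moment_iterate_sub_le hT F hk hD i
    _ = _ := by
        rw [sum_const, card_range, nsmul_eq_mul, ← mul_assoc, ← pow_succ]
        congr 2; omega

/-- Hölder: after the `2k`-th root, the sup bound `M` on the weight costs only a factor 2. This is
why `k` need only be logarithmic in `M`. -/
lemma abs_expect_mul_le_of_moment {w F : G → ℝ} (hw : ∀ y, 0 ≤ w y) {M E : ℝ} {k : ℕ} (hk : 1 ≤ k)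
    (hM : ∀ y, w y ≤ M) (hMk : M ≤ 2 ^ (2 * k)) (hw2 : 𝔼 y, w y ≤ 2) (hE : 0 ≤ E)
    (hF : 𝔼 y, F y ^ (2 * k) ≤ E ^ (2 * k)) : |𝔼 y, w y * F y| ≤ 4 * E := by
  have hM0 : 0 ≤ M := (hw 0).trans (hM 0)
  have hF0 : 0 ≤ 𝔼 y, F y ^ (2 * k) := expect_nonneg fun y _ => (even_two_mul k).pow_nonneg _
  have hW0 : 0 ≤ 𝔼 y, w y := expect_nonneg fun y _ => hw y
  refine le_of_pow_le_pow_left₀ (n := 2 * k) (by omega) (by positivity) ?_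
  rw [(even_two_mul k).pow_abs]
  calc (𝔼 y, w y * F y) ^ (2 * k)
      ≤ (𝔼 y, w y) ^ (2 * k - 1) * 𝔼 y, w y * F y ^ (2 * k) := pow_expect_mul_le w F hw hk
    _ ≤ 2 ^ (2 * k - 1) * (M * 𝔼 y, F y ^ (2 * k)) := by
        refine mul_le_mul (pow_le_pow_left₀ hW0 hw2 _) ?_
          (expect_nonneg fun y _ => mul_nonneg (hw y) ((even_two_mul k).pow_nonneg _))
          (by positivity)
        rw [Finset.mul_expect]
        exact expect_le_expect fun y _ =>
          mul_le_mul_of_nonneg_right (hM y) ((even_two_mul k).pow_nonneg _)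
    _ ≤ 2 ^ (2 * k) * (2 ^ (2 * k) * E ^ (2 * k)) := by
        gcongr
        · norm_num
        · omega
    _ = (4 * E) ^ (2 * k) := by
        rw [← mul_assoc, ← mul_pow, ← mul_pow]; norm_num

lemma expect_mul_finAvg (V : Finset G) (w F : G → ℝ) :
    𝔼 y, w y * finAvg V F y = 𝔼 y, (𝔼 v : V, w (y - v.1)) * F y := by
  simp only [finAvg, Finset.mul_expect, Finset.expect_mul]
  rw [Finset.expect_comm]
  conv_rhs => rw [Finset.expect_comm]
  refine Finset.expect_congr rfl fun v _ => ?_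
  rw [← expect_add_right (fun y => w (y - v.1) * F y) v.1]
  simp

/-- Replace `F` by its `l`-fold average `P`. The error is small in `L^{2k}` by almost periodicity,
both for `F` and, with `w` averaged instead, for its `V`-average. What remains is `P` minus its
`V`-average, exponentially small in `L²`. -/
lemma abs_expect_mul_sub_finAvg_le {T V : Finset G} (hT : T.Nonempty) (hV : V.Nonempty)
    (hTV : ∀ v ∈ V, ∀ ψ : AddChar G ℂ, 1 / 2 < ‖unifCoeff T ψ‖ → ψ v = 1)
    {w F : G → ℝ} (hw : ∀ y, 0 ≤ w y) {M N δ : ℝ} {k : ℕ} (hk : 1 ≤ k)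
    (hM1 : 1 ≤ M) (hM : ∀ y, w y ≤ M) (hMk : M ≤ 2 ^ (2 * k)) (hw2 : 𝔼 y, w y ≤ 2) (hN : 0 ≤ N)
    (hF : 𝔼 y, F y ^ (2 * k) ≤ N ^ (2 * k)) (hδ : 0 ≤ δ)
    (hper : ∀ t ∈ T, ∀ t' ∈ T, 𝔼 y, (F y - F (y + (t - t'))) ^ (2 * k) ≤ (δ * N) ^ (2 * k))
    (l : ℕ) :
    |𝔼 y, w y * (F y - finAvg V F y)| ≤ (8 * l * δ + 3 * M / 4 ^ l) * N := by
  have hVn : Nonempty V := hV.to_subtype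
  set P := (symAvg T)^[l] F with hP
  have hmom : 𝔼 y, (F y - P y) ^ (2 * k) ≤ (l * (δ * N)) ^ (2 * k) := by
    rw [mul_pow (l : ℝ)]
    exact moment_sub_iterate_le hT F hk hper l
  have h1 : |𝔼 y, w y * (F y - P y)| ≤ 4 * (l * (δ * N)) :=
    abs_expect_mul_le_of_moment hw hk hM hMk hw2 (by positivity) hmom
  have h2 : |𝔼 y, (𝔼 v : V, w (y - v.1)) * (F y - P y)| ≤ 4 * (l * (δ * N)) := by
    refine abs_expect_mul_le_of_moment (fun y => expect_nonneg fun v _ => hw _) hk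
      (fun y => expect_le univ_nonempty fun v _ => hM _) hMk ?_ (by positivity) hmom
    rw [Finset.expect_comm]
    refine expect_le univ_nonempty fun v _ => ?_
    simp_rw [sub_eq_add_neg]
    rw [expect_add_right w]
    exact hw2
  have h3 : |𝔼 y, w y * (P y - finAvg V P y)| ≤ 3 * M / 4 ^ l * N := by
    refine abs_le_of_sq_le_sq ?_ (by positivity)
    have hF2 : 𝔼 y, F y ^ 2 ≤ N ^ 2 := by
      refine le_of_pow_le_pow_left₀ (n := k) (by omega) (by positivity) ?_
      have := pow_expect_mul_le_of_nonneg (fun _ : G => (1 : ℝ)) (fun y => F y ^ 2) (by simp)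
        (fun y => sq_nonneg _) hk
      have hG : Nonempty G := ⟨0⟩
      simp only [one_mul, Fintype.expect_one, one_pow, ← pow_mul] at this
      rw [← pow_mul]
      exact this.trans hF
    calc (𝔼 y, w y * (P y - finAvg V P y)) ^ 2
        ≤ (𝔼 y, w y ^ 2) * 𝔼 y, (P y - finAvg V P y) ^ 2 :=
          Finset.expect_mul_sq_le_sq_mul_sq _ _ _
      _ ≤ (M * 2) * (4 * (1 / 16) ^ l * N ^ 2) := by
          have hS : 0 ≤ 𝔼 y, (P y - finAvg V P y) ^ 2 := expect_nonneg fun y _ => sq_nonneg _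
          refine mul_le_mul ?_ ?_ hS (by positivity)
          · calc 𝔼 y, w y ^ 2 ≤ 𝔼 y, M * w y := expect_le_expect fun y _ => by
                  rw [sq]; exact mul_le_mul_of_nonneg_right (hM y) (hw y)
              _ ≤ M * 2 := by rw [← Finset.mul_expect]; gcongr
          · refine (expect_sq_sub_finAvg_le hV hTV F l).trans ?_
            gcongr
      _ ≤ (3 * M / 4 ^ l * N) ^ 2 := by
          have h16 : ((1 : ℝ) / 16) ^ l = ((4 : ℝ) ^ l)⁻¹ ^ 2 := by
            rw [← inv_pow, ← pow_mul, mul_comm l 2, pow_mul]; norm_num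
          calc M * 2 * (4 * (1 / 16) ^ l * N ^ 2) = 8 * M * (((4 : ℝ) ^ l)⁻¹ ^ 2 * N ^ 2) := by
                rw [h16]; ring
            -- `√8` is rounded up to 3, and `M ≤ M²` because `M ≥ 1`.
            _ ≤ 9 * M ^ 2 * (((4 : ℝ) ^ l)⁻¹ ^ 2 * N ^ 2) := by
                gcongr ?_ * _
                nlinarith
            _ = _ := by rw [div_eq_mul_inv]; ring
  have hfin : ∀ y, finAvg V F y - finAvg V P y = finAvg V (fun y => F y - P y) y := fun y => by
    simp only [finAvg, Finset.expect_sub_distrib]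
  have hsplit : 𝔼 y, w y * (F y - finAvg V F y) = 𝔼 y, w y * (F y - P y) -
      𝔼 y, (𝔼 v : V, w (y - v.1)) * (F y - P y) + 𝔼 y, w y * (P y - finAvg V P y) := by
    rw [← expect_mul_finAvg V w (fun y => F y - P y), ← Finset.expect_sub_distrib,
      ← Finset.expect_add_distrib]
    refine Finset.expect_congr rfl fun y _ => ?_
    rw [← hfin]; ring
  rw [hsplit, abs_le]
  rw [abs_le] at h1 h2 h3
  constructor <;> nlinarith

end SpectralBoosting

/-! ### Characters and annihilators in `𝔽_p^n`; bilinear almost periodicity. -/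

namespace SpectralBoosting

open Finset

variable {p : ℕ} [Fact p.Prime] {n : ℕ}

/-- The character `x ↦ exp(2πi (γ ⬝ x) / p)` of `𝔽_p^n`. -/
noncomputable def chi (γ : Fin n → ZMod p) : AddChar (Fin n → ZMod p) ℂ :=
  ZMod.stdAddChar.compAddMonoidHom (AddMonoidHom.mk' (fun x => γ ⬝ᵥ x) (dotProduct_add γ))

lemma chi_apply (γ x : Fin n → ZMod p) : chi γ x = ZMod.stdAddChar (γ ⬝ᵥ x) := rfl

lemma chi_apply_eq_one_iff (γ x : Fin n → ZMod p) : chi γ x = 1 ↔ γ ⬝ᵥ x = 0 := by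
  rw [chi_apply, ← (ZMod.stdAddChar (N := p)).map_zero_eq_one]
  exact ZMod.injective_stdAddChar.eq_iff

/-- `chi` as a homomorphism to the dual group. -/
noncomputable def chiHom : (Fin n → ZMod p) →+ AddChar (Fin n → ZMod p) ℂ :=
  AddMonoidHom.mk' chi fun γ γ' => by
    ext x
    rw [AddChar.add_apply, chi_apply, chi_apply, chi_apply, add_dotProduct,
      AddChar.map_add_eq_mul]

lemma chiHom_apply (γ : Fin n → ZMod p) : chiHom γ = chi γ := rfl

lemma chi_injective : Function.Injective (chi : (Fin n → ZMod p) → _) := by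
  change Function.Injective (chiHom : (Fin n → ZMod p) → _)
  rw [injective_iff_map_eq_zero]
  intro γ hγ
  funext i
  have h : chi γ (Pi.single i 1) = 1 := by
    rw [← chiHom_apply, hγ, AddChar.zero_apply]
  rw [chi_apply_eq_one_iff] at h
  simpa using h

lemma chi_surjective : Function.Surjective (chi : (Fin n → ZMod p) → _) :=
  ((Fintype.bijective_iff_injective_and_card _).2 ⟨chi_injective, AddChar.card_eq.symm⟩).2

lemma expect_chi (γ : Fin n → ZMod p) : 𝔼 x, chi γ x = if γ = 0 then 1 else 0 := by
  classical
  rw [AddChar.expect_eq_ite]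
  have : chi γ = 0 ↔ γ = 0 := by
    rw [← chiHom_apply, map_eq_zero_iff chiHom chi_injective]
  simp [this]

/-- The subspace orthogonal to a finite set. -/
noncomputable def perp (Λ : Finset (Fin n → ZMod p)) : Submodule (ZMod p) (Fin n → ZMod p) :=
  LinearMap.ker (LinearMap.pi fun γ : Λ => dotProductBilin (ZMod p) (ZMod p) γ.1)

lemma mem_perp {Λ : Finset (Fin n → ZMod p)} {x : Fin n → ZMod p} :
    x ∈ perp Λ ↔ ∀ γ ∈ Λ, γ ⬝ᵥ x = 0 := by
  simp [perp, LinearMap.mem_ker, funext_iff]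

lemma finrank_quotient_perp_le (Λ : Finset (Fin n → ZMod p)) :
    Module.finrank (ZMod p) ((Fin n → ZMod p) ⧸ perp Λ) ≤ #Λ := by
  have e := (LinearMap.pi fun γ : Λ =>
    dotProductBilin (ZMod p) (ZMod p) γ.1 : (Fin n → ZMod p) →ₗ[ZMod p] _).quotKerEquivRange
  calc _ = Module.finrank (ZMod p) (LinearMap.range (LinearMap.pi fun γ : Λ =>
          dotProductBilin (ZMod p) (ZMod p) γ.1 : (Fin n → ZMod p) →ₗ[ZMod p] _)) := e.finrank_eq
    _ ≤ Module.finrank (ZMod p) (Λ → ZMod p) := Submodule.finrank_le _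
    _ = #Λ := by simp

lemma dotProduct_eq_zero_of_mem_span {S : Set (Fin n → ZMod p)} {γ x : Fin n → ZMod p}
    (hγ : γ ∈ Submodule.span (ZMod p) S) (hx : ∀ γ ∈ S, γ ⬝ᵥ x = 0) : γ ⬝ᵥ x = 0 := by
  induction hγ using Submodule.span_induction with
  | mem y hy => exact hx y hy
  | zero => simp
  | add y z _ _ hy hz => rw [add_dotProduct, hy, hz, add_zero]
  | smul a y _ hy => rw [smul_dotProduct, hy, smul_zero]

/-- Two equal subset sums are two 0/1 combinations of independent vectors, hence have the same
coefficients. -/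
lemma addDissociated_image_chi (Λ : Finset (Fin n → ZMod p))
    (hΛ : LinearIndepOn (ZMod p) id (Λ : Set (Fin n → ZMod p))) :
    AddDissociated (chi '' (Λ : Set (Fin n → ZMod p))) := by
  classical
  have hpre : ∀ t : Finset (AddChar (Fin n → ZMod p) ℂ),
      (t : Set (AddChar (Fin n → ZMod p) ℂ)) ⊆ chi '' (Λ : Set (Fin n → ZMod p)) →
      ∃ t' ⊆ Λ, t = t'.image chi := by
    intro t ht
    obtain ⟨t', ht', h⟩ := Finset.subset_set_image_iff.1 ht
    exact ⟨t', by exact_mod_cast ht', h.symm⟩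
  intro t ht u hu htu
  obtain ⟨t', ht', rfl⟩ := hpre t ht
  obtain ⟨u', hu', rfl⟩ := hpre u hu
  have hsum : ∀ s : Finset (Fin n → ZMod p), ∑ x ∈ s.image chi, x = chiHom (∑ γ ∈ s, γ) := by
    intro s
    rw [Finset.sum_image chi_injective.injOn, map_sum]
    rfl
  simp only [hsum] at htu
  have heq : ∑ γ ∈ t', γ = ∑ γ ∈ u', γ := chi_injective htu
  have h := (linearIndepOn_finset_iffₛ.1 hΛ) (fun γ => if γ ∈ t' then 1 else 0)
    (fun γ => if γ ∈ u' then 1 else 0) (by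
      simpa [ite_smul, Finset.sum_ite_mem, inter_eq_right.2 ht', inter_eq_right.2 hu'] using heq)
  congr 1
  ext γ
  constructor
  · intro hγ
    have := h γ (ht' hγ)
    by_contra hn
    simp [hγ, hn] at this
  · intro hγ
    have := h γ (hu' hγ)
    by_contra hn
    simp [hγ, hn] at this

/-- The annihilator of the large spectrum of `T` has codimension logarithmic in the density. -/
lemma exists_subspace_annihilating {T : Finset (Fin n → ZMod p)} (hT : T.Nonempty) :
    ∃ V : Submodule (ZMod p) (Fin n → ZMod p),
      (Module.finrank (ZMod p) ((Fin n → ZMod p) ⧸ V) : ℝ) ≤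
        8 * Real.log (Fintype.card (Fin n → ZMod p) / #T) ∧
      ∀ v ∈ V, ∀ ψ : AddChar (Fin n → ZMod p) ℂ, 1 / 2 < ‖unifCoeff T ψ‖ → ψ v = 1 := by
  classical
  -- A basis of the span taken inside the large spectrum: Chang's lemma bounds its size, and
  -- annihilating it annihilates the whole spectrum.
  obtain ⟨Λ', hsub, hspan, hind⟩ := exists_linearIndependent (ZMod p)
    {γ : Fin n → ZMod p | 1 / 2 < ‖unifCoeff T (chi γ)‖}
  set Λ := Λ'.toFinite.toFinset with hΛ
  have hcoe : (Λ : Set (Fin n → ZMod p)) = Λ' := by simp [hΛ]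
  refine ⟨perp Λ, ?_, ?_⟩
  · have h := card_le_of_addDissociated hT (Λ.image chi) (by
      rw [coe_image]
      refine addDissociated_image_chi Λ ?_
      rw [hcoe]
      exact hind) (by
      intro ψ hψ
      obtain ⟨γ, hγ, rfl⟩ := mem_image.1 hψ
      have : γ ∈ Λ' := by rw [← hcoe]; exact hγ
      exact (hsub this).le)
    rw [card_image_of_injective _ chi_injective] at h
    exact (Nat.cast_le.2 (finrank_quotient_perp_le Λ)).trans h
  · intro v hv ψ hψ
    obtain ⟨γ, rfl⟩ := chi_surjective ψ
    rw [chi_apply_eq_one_iff]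
    have hmem : γ ∈ Submodule.span (ZMod p) Λ' := by
      rw [hspan]; exact Submodule.subset_span hψ
    refine dotProduct_eq_zero_of_mem_span hmem fun γ' hγ' => mem_perp.1 hv γ' ?_
    have : γ' ∈ (Λ : Set _) := by rw [hcoe]; exact hγ'
    exact this

/-- The elements of a subspace as a finset. -/
noncomputable def elems (V : Submodule (ZMod p) (Fin n → ZMod p)) : Finset (Fin n → ZMod p) :=
  (V : Set (Fin n → ZMod p)).toFinite.toFinset

lemma mem_elems {V : Submodule (ZMod p) (Fin n → ZMod p)} {x : Fin n → ZMod p} :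
    x ∈ elems V ↔ x ∈ V := by
  simp [elems]

lemma elems_nonempty (V : Submodule (ZMod p) (Fin n → ZMod p)) : (elems V).Nonempty :=
  ⟨0, mem_elems.2 V.zero_mem⟩

/-- Bilinear almost periodicity: in a pairing with `w`, the average of `g` over the reflected
translates of `B` may be smoothed over a subspace of small codimension. -/
lemma exists_subspace_abs_expect_le {B : Finset (Fin n → ZMod p)} (hB : B.Nonempty)
    {w g : (Fin n → ZMod p) → ℝ} (hw : ∀ y, 0 ≤ w y) {M N δ : ℝ} {k q : ℕ} (hk : 1 ≤ k)
    (hq : 1 ≤ q) (hM1 : 1 ≤ M) (hM : ∀ y, w y ≤ M) (hMk : M ≤ 2 ^ (2 * k)) (hw2 : 𝔼 y, w y ≤ 2)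
    (hN : 0 ≤ N) (hg : 𝔼 y, g y ^ (2 * k) ≤ N ^ (2 * k)) (hδ : 0 ≤ δ)
    (hδq : 64 * (k : ℝ) ^ 2 ≤ δ ^ 2 * q) (l : ℕ) :
    ∃ V : Submodule (ZMod p) (Fin n → ZMod p),
      (Module.finrank (ZMod p) ((Fin n → ZMod p) ⧸ V) : ℝ) ≤
        8 * (q * Real.log (Fintype.card (Fin n → ZMod p) / #B) + 1) ∧
      |𝔼 y, w y * (refAvg B g y - finAvg (elems V) (refAvg B g) y)| ≤
        (8 * l * δ + 3 * M / 4 ^ l) * N := by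
  obtain ⟨T, hTcard, hper⟩ := exists_almost_periods hB g hk hq hδq
  have hG : (0 : ℝ) < Fintype.card (Fin n → ZMod p) := by exact_mod_cast Fintype.card_pos
  have hB0 : (0 : ℝ) < #B := by exact_mod_cast hB.card_pos
  have hTpos : (0 : ℝ) < (#T : ℝ) / Fintype.card (Fin n → ZMod p) :=
    lt_of_lt_of_le (by positivity) hTcard
  have hT : T.Nonempty := by
    rw [nonempty_iff_ne_empty]
    rintro rfl
    simp at hTpos
  obtain ⟨V, hVdim, hV⟩ := exists_subspace_annihilating hT
  refine ⟨V, hVdim.trans ?_, ?_⟩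
  · gcongr
    have h1 : (Fintype.card (Fin n → ZMod p) : ℝ) / #T ≤
        ((Fintype.card (Fin n → ZMod p) : ℝ) / #B) ^ q * 2 := by
      rw [← inv_div, ← inv_div (#B : ℝ), inv_pow]
      calc _ ≤ (((#B : ℝ) / Fintype.card (Fin n → ZMod p)) ^ q / 2)⁻¹ :=
            inv_anti₀ (by positivity) hTcard
        _ = _ := by rw [inv_div]; field_simp
    have hT0 : (0 : ℝ) < #T := by exact_mod_cast hT.card_pos
    calc _ ≤ Real.log (((Fintype.card (Fin n → ZMod p) : ℝ) / #B) ^ q * 2) :=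
          Real.log_le_log (by positivity) h1
      _ = q * Real.log (Fintype.card (Fin n → ZMod p) / #B) + Real.log 2 := by
          rw [Real.log_mul (by positivity) (by norm_num), Real.log_pow]
      _ ≤ _ := by gcongr; linarith [Real.log_two_lt_d9]
  · refine abs_expect_mul_sub_finAvg_le hT (elems_nonempty V)
      (fun v hv => hV v (mem_elems.1 hv)) hw hk hM1 hM hMk hw2 hN
      ((moment_refAvg_le hB g hk).trans hg) hδ (fun t ht t' ht' => ?_) l
    refine (hper t ht t' ht').trans ?_
    rw [mul_pow]
    gcongr

end SpectralBoosting

/-! ### From a bilinear correlation to a density increment. -/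

namespace SpectralBoosting

open Finset

lemma ind_nonneg {G : Type*} (S : Set G) (x : G) : 0 ≤ ind S x :=
  Set.indicator_nonneg (fun _ _ => zero_le_one) x

lemma ind_le_one {G : Type*} (S : Set G) (x : G) : ind S x ≤ 1 :=
  Set.indicator_le' (fun _ _ => le_rfl) (fun _ _ => zero_le_one) x

lemma ind_coe_eq_ite {G : Type*} [DecidableEq G] (S : Finset G) (x : G) :
    ind (S : Set G) x = if x ∈ S then 1 else 0 := by
  simp [ind, Set.indicator_apply]

lemma expect_ind_mul {G : Type*} [Fintype G] (S : Finset G) (hS : S.Nonempty) (F : G → ℝ) :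
    𝔼 x, ind (S : Set G) x * F x = (#S : ℝ) / Fintype.card G * 𝔼 b : S, F b.1 := by
  classical
  have h0 : (#S : ℝ) ≠ 0 := by exact_mod_cast hS.card_pos.ne'
  rw [Fintype.expect_eq_sum_div_card, Fintype.expect_eq_sum_div_card, Fintype.card_coe,
    Finset.sum_coe_sort S F, div_mul_div_comm, mul_comm (#S : ℝ), mul_div_mul_right _ _ h0]
  simp [ind_coe_eq_ite]

lemma expect_ind {G : Type*} [Fintype G] (S : Finset G) :
    𝔼 x, ind (S : Set G) x = (#S : ℝ) / Fintype.card G := by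
  classical
  rw [Fintype.expect_eq_sum_div_card]
  simp [ind_coe_eq_ite]

section Average

variable {p : ℕ} [Fact p.Prime] {n : ℕ} (V : Submodule (ZMod p) (Fin n → ZMod p))

lemma expect_elems_add (F : (Fin n → ZMod p) → ℝ) {u : Fin n → ZMod p} (hu : u ∈ V) :
    𝔼 v : elems V, F (v.1 + u) = 𝔼 v : elems V, F v.1 := by
  refine Fintype.expect_equiv
    ((Equiv.addRight u).subtypeEquiv fun v => ?_) _ _ fun v => rfl
  rw [mem_elems, mem_elems, Equiv.coe_addRight, Submodule.add_mem_iff_left _ hu]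

lemma expect_elems_neg (F : (Fin n → ZMod p) → ℝ) :
    𝔼 v : elems V, F (-v.1) = 𝔼 v : elems V, F v.1 := by
  refine Fintype.expect_equiv
    ((Equiv.neg _).subtypeEquiv fun v => ?_) _ _ fun v => rfl
  rw [mem_elems, mem_elems, Equiv.neg_apply, Submodule.neg_mem_iff]

lemma finAvg_elems_idem (F : (Fin n → ZMod p) → ℝ) :
    finAvg (elems V) (finAvg (elems V) F) = finAvg (elems V) F := by
  have : Nonempty (elems V) := (elems_nonempty V).to_subtype
  funext y
  rw [finAvg]
  have : ∀ u : elems V, finAvg (elems V) F (y + u.1) = finAvg (elems V) F y := by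
    intro u
    rw [finAvg, finAvg, ← expect_elems_add V (fun v => F (y + v)) (mem_elems.1 u.2)]
    exact Finset.expect_congr rfl fun v _ => by congr 1; abel
  simp_rw [this]
  exact Fintype.expect_const _

lemma expect_mul_finAvg_elems (w F : (Fin n → ZMod p) → ℝ) :
    𝔼 y, w y * finAvg (elems V) F y = 𝔼 y, finAvg (elems V) w y * F y := by
  rw [expect_mul_finAvg]
  refine Finset.expect_congr rfl fun y _ => ?_
  rw [finAvg, ← expect_elems_neg V (fun v => w (y + v))]
  simp [sub_eq_add_neg]

lemma expect_finAvg (F : (Fin n → ZMod p) → ℝ) :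
    𝔼 y, finAvg (elems V) F y = 𝔼 y, F y := by
  have : Nonempty (elems V) := (elems_nonempty V).to_subtype
  simp only [finAvg]
  rw [Finset.expect_comm]
  simp_rw [expect_add_right]
  exact Fintype.expect_const _

end Average

/-- The upper bound is `(1 + κ)² ≤ 1 + 3κ`. The lower bound averages `(1 + κ - b₁)(1 + κ - b₂) ≥ 0`,
so only the mean deficits of `b₁` and `b₂` enter. -/
lemma abs_expect_mul_sub_one_le {G : Type*} [AddCommGroup G] [Fintype G] {b₁ b₂ : G → ℝ} {κ : ℝ}
    (hκ0 : 0 ≤ κ) (hκ1 : κ ≤ 1) (h1 : ∀ y, 0 ≤ b₁ y)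
    (h1' : ∀ y, b₁ y ≤ 1 + κ) (h2' : ∀ y, b₂ y ≤ 1 + κ) (z : G) :
    |(𝔼 y, b₂ y * b₁ (z + y)) - 1| ≤
      3 * κ + 2 * ((1 + κ - 𝔼 y, b₁ y) + (1 + κ - 𝔼 y, b₂ y)) := by
  have hG : Nonempty G := ⟨0⟩
  have hm1 : 𝔼 y, b₁ y ≤ 1 + κ := expect_le univ_nonempty fun y _ => h1' y
  have hm2 : 𝔼 y, b₂ y ≤ 1 + κ := expect_le univ_nonempty fun y _ => h2' y
  have hup : 𝔼 y, b₂ y * b₁ (z + y) ≤ (1 + κ) ^ 2 :=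
    expect_le univ_nonempty fun y _ => by
      rw [sq]; exact mul_le_mul (h2' y) (h1' _) (h1 _) (by linarith)
  have hlow : (1 + κ) ^ 2 - (1 + κ) * ((1 + κ - 𝔼 y, b₁ y) + (1 + κ - 𝔼 y, b₂ y)) ≤
      𝔼 y, b₂ y * b₁ (z + y) := by
    have hsh : 𝔼 y, b₁ (z + y) = 𝔼 y, b₁ y := by
      simp_rw [add_comm z]; exact expect_add_right b₁ z
    calc _ = 𝔼 y, ((1 + κ) * b₁ (z + y) + (1 + κ) * b₂ y - (1 + κ) ^ 2) := by
          rw [Finset.expect_sub_distrib, Finset.expect_add_distrib, Fintype.expect_const,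
            ← Finset.mul_expect, ← Finset.mul_expect, hsh]
          ring
      _ ≤ _ := expect_le_expect fun y _ => by
          nlinarith [mul_nonneg (sub_nonneg.2 (h1' (z + y))) (sub_nonneg.2 (h2' y))]
  rw [abs_le]
  constructor <;> nlinarith

lemma abs_expect_le_of_moment {G : Type*} [Fintype G] [Nonempty G] {g : G → ℝ} {N : ℝ} {k : ℕ}
    (hk : 1 ≤ k) (hN : 0 ≤ N) (hg : 𝔼 y, g y ^ (2 * k) ≤ N ^ (2 * k)) : 𝔼 y, |g y| ≤ N := by
  refine le_of_pow_le_pow_left₀ (n := 2 * k) (by omega) hN ?_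
  refine (pow_expect_le _ hk).trans ?_
  simpa only [(even_two_mul k).pow_abs] using hg

/-- The pairing of two dense sets with a function of bounded `2k`-th moment is bounded. -/
lemma abs_expect_expect_mul_le {G : Type*} [AddCommGroup G] [Fintype G] {a₁ a₂ g : G → ℝ}
    {M N : ℝ} {k : ℕ} (hk : 1 ≤ k) (hN : 0 ≤ N) (h1 : ∀ y, 0 ≤ a₁ y) (h2 : ∀ y, 0 ≤ a₂ y)
    (hM : ∀ y, a₁ y ≤ M) (hMk : M ≤ 2 ^ (2 * k)) (hm1 : 𝔼 y, a₁ y ≤ 2) (hm2 : 𝔼 y, a₂ y ≤ 2)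
    (hg : 𝔼 y, g y ^ (2 * k) ≤ N ^ (2 * k)) :
    |𝔼 y, 𝔼 x, a₂ y * a₁ x * g (x - y)| ≤ 8 * N := by
  have hM0 : 0 ≤ M := (h1 0).trans (hM 0)
  have hm10 : 0 ≤ 𝔼 y, a₁ y := expect_nonneg fun y _ => h1 y
  have hm20 : 0 ≤ 𝔼 y, a₂ y := expect_nonneg fun y _ => h2 y
  have hN0 : 0 ≤ N ^ (2 * k) := (even_two_mul k).pow_nonneg _
  refine le_of_pow_le_pow_left₀ (n := 2 * k) (by omega) (by positivity) ?_
  rw [(even_two_mul k).pow_abs]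
  have hprod : ∀ F : G → G → ℝ, 𝔼 y, 𝔼 x, F y x = 𝔼 s : G × G, F s.1 s.2 := fun F => by
    rw [← Finset.univ_product_univ, Finset.expect_product]
  rw [hprod (fun y x => a₂ y * a₁ x * g (x - y))]
  refine (pow_expect_mul_le (fun s : G × G => a₂ s.1 * a₁ s.2) (fun s => g (s.2 - s.1))
    (fun s => mul_nonneg (h2 _) (h1 _)) hk).trans ?_
  have e1 : 𝔼 s : G × G, a₂ s.1 * a₁ s.2 ≤ 4 := by
    rw [← hprod (fun y x => a₂ y * a₁ x), ← Finset.expect_mul_expect]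
    nlinarith
  have e2 : 𝔼 s : G × G, a₂ s.1 * a₁ s.2 * g (s.2 - s.1) ^ (2 * k) ≤
      2 ^ (2 * k) * (2 * N ^ (2 * k)) := by
    rw [← hprod (fun y x => a₂ y * a₁ x * g (x - y) ^ (2 * k))]
    calc 𝔼 y, 𝔼 x, a₂ y * a₁ x * g (x - y) ^ (2 * k)
        ≤ 𝔼 y, 𝔼 x, a₂ y * M * g (x - y) ^ (2 * k) := by
          refine expect_le_expect fun y _ => expect_le_expect fun x _ => ?_
          exact mul_le_mul_of_nonneg_right (mul_le_mul_of_nonneg_left (hM x) (h2 y))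
            ((even_two_mul k).pow_nonneg _)
      _ = (𝔼 y, a₂ y) * (M * 𝔼 x, g x ^ (2 * k)) := by
          rw [Finset.expect_mul]
          refine Finset.expect_congr rfl fun y _ => ?_
          rw [← Finset.mul_expect, mul_assoc]
          simp_rw [sub_eq_add_neg]
          rw [expect_add_right (fun x => g x ^ (2 * k))]
      _ ≤ 2 * (2 ^ (2 * k) * N ^ (2 * k)) := by
          have hg0 : 0 ≤ 𝔼 x, g x ^ (2 * k) :=
            expect_nonneg fun x _ => (even_two_mul k).pow_nonneg _
          exact mul_le_mul hm2 (mul_le_mul hMk hg hg0 (by positivity)) (by positivity) (by norm_num)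
      _ = _ := by ring
  calc _ ≤ (4 : ℝ) ^ (2 * k - 1) * (2 ^ (2 * k) * (2 * N ^ (2 * k))) := by
        refine mul_le_mul (pow_le_pow_left₀ (expect_nonneg fun s _ => mul_nonneg (h2 _) (h1 _)) e1 _)
          e2 (expect_nonneg fun s _ => mul_nonneg (mul_nonneg (h2 _) (h1 _))
            ((even_two_mul k).pow_nonneg _)) (by positivity)
    _ ≤ 4 ^ (2 * k - 1) * (2 ^ (2 * k) * (4 * N ^ (2 * k))) := by gcongr; norm_num
    _ = 4 ^ (2 * k - 1 + 1) * (2 ^ (2 * k) * N ^ (2 * k)) := by rw [pow_succ]; ring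
    _ = (8 * N) ^ (2 * k) := by
        rw [show 2 * k - 1 + 1 = 2 * k by omega, ← mul_assoc, ← mul_pow, ← mul_pow]; norm_num

/-- If two sets of density about `α` correlate with a function `g` much more than they should,
then one of them has a density increment on a translate of a subspace of small codimension. -/
lemma exists_increment_of_correlation {p : ℕ} [Fact p.Prime] {d : ℕ} {α κ c N δ : ℝ} {k q l : ℕ}
    (hα0 : 0 < α) (hα1 : α ≤ 1) (hκ0 : 0 ≤ κ) (hκ1 : κ ≤ 1) (hκc : 3 * κ ≤ c / 2)
    (B₁ B₂ : Finset (Fin d → ZMod p)) (g : (Fin d → ZMod p) → ℝ)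
    (hm1 : α⁻¹ * 𝔼 x, ind (B₁ : Set (Fin d → ZMod p)) x ≤ 1 + κ)
    (hm2 : α⁻¹ * 𝔼 x, ind (B₂ : Set (Fin d → ZMod p)) x ≤ 1 + κ)
    (hk : 1 ≤ k) (hαk : α⁻¹ ≤ 2 ^ (2 * k)) (hN : 0 ≤ N) (hg : 𝔼 y, g y ^ (2 * k) ≤ N ^ (2 * k))
    (hq : 1 ≤ q) (hδ : 0 ≤ δ) (hδq : 64 * (k : ℝ) ^ 2 ≤ δ ^ 2 * q)
    (herr : 2 * (8 * l * δ + 3 * α⁻¹ / 4 ^ l) ≤ c / 2)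
    (hcorr : (c + 18 * ((1 + κ - α⁻¹ * 𝔼 x, ind (B₁ : Set (Fin d → ZMod p)) x) +
      (1 + κ - α⁻¹ * 𝔼 x, ind (B₂ : Set (Fin d → ZMod p)) x))) * N <
      (𝔼 y, 𝔼 x, α⁻¹ * ind (B₂ : Set (Fin d → ZMod p)) y *
        (α⁻¹ * ind (B₁ : Set (Fin d → ZMod p)) x) * g (x - y)) - 𝔼 x, g x) :
    ∃ V : Submodule (ZMod p) (Fin d → ZMod p),
      (Module.finrank (ZMod p) ((Fin d → ZMod p) ⧸ V) : ℝ) ≤ 8 * (q * Real.log (2 / α) + 1) ∧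
      ∃ y, 1 + κ < finAvg (elems V) (fun x => α⁻¹ * ind (B₁ : Set (Fin d → ZMod p)) x) y ∨
        1 + κ < finAvg (elems V) (fun x => α⁻¹ * ind (B₂ : Set (Fin d → ZMod p)) x) y := by
  set a₁ : (Fin d → ZMod p) → ℝ := fun x => α⁻¹ * ind (B₁ : Set (Fin d → ZMod p)) x with ha₁
  set a₂ : (Fin d → ZMod p) → ℝ := fun x => α⁻¹ * ind (B₂ : Set (Fin d → ZMod p)) x with ha₂
  have hα' : 0 < α⁻¹ := inv_pos.2 hα0
  have h1 : ∀ x, 0 ≤ a₁ x := fun x => mul_nonneg hα'.le (ind_nonneg _ _)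
  have h2 : ∀ x, 0 ≤ a₂ x := fun x => mul_nonneg hα'.le (ind_nonneg _ _)
  have h1M : ∀ x, a₁ x ≤ α⁻¹ := fun x => mul_le_of_le_one_right hα'.le (ind_le_one _ _)
  have h2M : ∀ x, a₂ x ≤ α⁻¹ := fun x => mul_le_of_le_one_right hα'.le (ind_le_one _ _)
  have e1 : α⁻¹ * 𝔼 x, ind (B₁ : Set (Fin d → ZMod p)) x = 𝔼 x, a₁ x := Finset.mul_expect ..
  have e2 : α⁻¹ * 𝔼 x, ind (B₂ : Set (Fin d → ZMod p)) x = 𝔼 x, a₂ x := Finset.mul_expect ..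
  have hcard : α⁻¹ * ((#B₁ : ℝ) / Fintype.card (Fin d → ZMod p)) = 𝔼 x, a₁ x := by
    rw [← e1, expect_ind]
  rw [e1] at hm1 hcorr
  rw [e2] at hm2 hcorr
  change (c + 18 * ((1 + κ - 𝔼 x, a₁ x) + (1 + κ - 𝔼 x, a₂ x))) * N <
    (𝔼 y, 𝔼 x, a₂ y * a₁ x * g (x - y)) - 𝔼 x, g x at hcorr
  have habs := abs_expect_le_of_moment hk hN hg
  have hgN : |𝔼 x, g x| ≤ N := (Finset.abs_expect_le _ _).trans habs
  have hT8 := abs_expect_expect_mul_le hk hN h1 h2 h1M hαk (by linarith) (by linarith) hg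
  -- The pairing and the mean of `g` together contribute at most `8N + N`. A mean below 1/2 would
  -- make the deficit term alone reach `18 · N/2 = 9N`; this fixes the constant 18.
  have hhalf : 1 / 2 ≤ 𝔼 x, a₁ x := by
    by_contra! hlt
    have : 9 * N ≤ (c + 18 * ((1 + κ - 𝔼 x, a₁ x) + (1 + κ - 𝔼 x, a₂ x))) * N := by
      gcongr; linarith
    linarith [le_abs_self (𝔼 y, 𝔼 x, a₂ y * a₁ x * g (x - y)), neg_abs_le (𝔼 x, g x)]
  have hG : (0 : ℝ) < Fintype.card (Fin d → ZMod p) := by exact_mod_cast Fintype.card_pos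
  have hB : B₁.Nonempty := by
    rw [nonempty_iff_ne_empty]
    rintro rfl
    rw [← hcard] at hhalf
    norm_num at hhalf
  have hB0 : (0 : ℝ) < #B₁ := by exact_mod_cast hB.card_pos
  obtain ⟨V, hVdim, hV⟩ := exists_subspace_abs_expect_le hB h2 hk hq ((one_le_inv₀ hα0).2 hα1) h2M
    hαk (by linarith) hN hg hδ hδq l
  refine ⟨V, hVdim.trans ?_, ?_⟩
  · have hle : (Fintype.card (Fin d → ZMod p) : ℝ) / #B₁ ≤ 2 / α := ?_
    · gcongr
    rw [div_le_div_iff₀ hB0 hα0]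
    rw [← hcard, inv_mul_eq_div, div_div, le_div_iff₀ (by positivity)] at hhalf
    linarith
  by_contra! hno
  have hb1 : ∀ y, finAvg (elems V) a₁ y ≤ 1 + κ := fun y => (hno y).1
  have hb2 : ∀ y, finAvg (elems V) a₂ y ≤ 1 + κ := fun y => (hno y).2
  set m := 𝔼 x, a₁ x with hm
  have hΨ : ∀ y, 𝔼 x, a₁ x * g (x - y) = m * refAvg B₁ g y := by
    intro y
    simp only [ha₁, mul_assoc]
    rw [← Finset.mul_expect, expect_ind_mul B₁ hB (fun x => g (x - y)), ← mul_assoc, hcard, refAvg]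
  have hTeq : 𝔼 y, 𝔼 x, a₂ y * a₁ x * g (x - y) = m * 𝔼 y, a₂ y * refAvg B₁ g y := by
    rw [Finset.mul_expect]
    refine Finset.expect_congr rfl fun y _ => ?_
    simp_rw [mul_assoc]
    rw [← Finset.mul_expect, hΨ]; ring
  have hAΨ : ∀ y, m * finAvg (elems V) (refAvg B₁ g) y =
      𝔼 z, finAvg (elems V) a₁ (z + y) * g z := by
    intro y
    simp only [finAvg, Finset.mul_expect, Finset.expect_mul, ← hΨ]
    conv_rhs => rw [Finset.expect_comm]
    refine Finset.expect_congr rfl fun v _ => ?_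
    rw [← expect_add_right (fun x => a₁ x * g (x - (y + v.1))) (y + v.1)]
    refine Finset.expect_congr rfl fun x _ => ?_
    rw [add_sub_cancel_right, add_assoc]
  -- Averaging over `V` is idempotent, so one average can be moved onto each of the two sets.
  have hTV : m * 𝔼 y, a₂ y * finAvg (elems V) (refAvg B₁ g) y =
      𝔼 z, (𝔼 y, finAvg (elems V) a₂ y * finAvg (elems V) a₁ (z + y)) * g z := by
    rw [← finAvg_elems_idem V (refAvg B₁ g), expect_mul_finAvg_elems, Finset.mul_expect]
    simp_rw [mul_left_comm m, hAΨ, Finset.expect_mul, Finset.mul_expect, mul_assoc]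
    rw [Finset.expect_comm]
  have hmain : m * (𝔼 y, a₂ y * finAvg (elems V) (refAvg B₁ g) y) - 𝔼 x, g x ≤
      (3 * κ + 2 * ((1 + κ - m) + (1 + κ - 𝔼 x, a₂ x))) * N := by
    rw [hTV, ← Finset.expect_sub_distrib]
    have hn1 : ∀ y, 0 ≤ finAvg (elems V) a₁ y := fun y => expect_nonneg fun v _ => h1 _
    calc _ ≤ 𝔼 z, (3 * κ + 2 * ((1 + κ - m) + (1 + κ - 𝔼 x, a₂ x))) * |g z| := by
          refine expect_le_expect fun z _ => ?_
          have := abs_expect_mul_sub_one_le hκ0 hκ1 hn1 hb1 hb2 z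
          rw [expect_finAvg, expect_finAvg] at this
          rw [← sub_one_mul]
          refine (le_abs_self _).trans ?_
          rw [abs_mul]
          exact mul_le_mul_of_nonneg_right this (abs_nonneg _)
      _ ≤ _ := by
          rw [← Finset.mul_expect]
          refine mul_le_mul_of_nonneg_left habs ?_
          linarith
  have hdiff : (𝔼 y, 𝔼 x, a₂ y * a₁ x * g (x - y)) -
      m * 𝔼 y, a₂ y * finAvg (elems V) (refAvg B₁ g) y ≤ c / 2 * N := by
    rw [hTeq, ← mul_sub, ← Finset.expect_sub_distrib]
    simp_rw [← mul_sub]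
    calc _ ≤ m * |𝔼 y, a₂ y * (refAvg B₁ g y - finAvg (elems V) (refAvg B₁ g) y)| := by
          gcongr
          exact le_abs_self _
      _ ≤ 2 * ((8 * l * δ + 3 * α⁻¹ / 4 ^ l) * N) := by
          refine mul_le_mul (by linarith) hV (abs_nonneg _) (by norm_num)
      _ = (2 * (8 * l * δ + 3 * α⁻¹ / 4 ^ l)) * N := by ring
      _ ≤ _ := by gcongr
  -- With no increment, smoothing loses `c/2`, and the smoothed pairing exceeds the mean of `g` by
  -- at most `3κ ≤ c/2` plus twice the deficits. Together this is less than the assumed excess.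
  have : (c / 2 + (3 * κ + 2 * ((1 + κ - m) + (1 + κ - 𝔼 x, a₂ x)))) * N ≤
      (c + 18 * ((1 + κ - m) + (1 + κ - 𝔼 x, a₂ x))) * N := by
    refine mul_le_mul_of_nonneg_right ?_ hN
    linarith
  linarith

end SpectralBoosting

/-! ### Numerical parameters. -/

namespace SpectralBoosting

open Finset

lemma two_le_log_four_div {α K : ℝ} (hα0 : 0 < α) (hα1 : α ≤ 1) (hK : 2 ≤ K) :
    2 ≤ Real.log (4 / (α / K)) := by
  have h8 : (8 : ℝ) ≤ 4 / (α / K) := by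
    rw [le_div_iff₀ (by positivity), mul_div_assoc', div_le_iff₀ (by positivity)]
    nlinarith
  calc (2 : ℝ) ≤ Real.log 8 := by
        rw [show (8 : ℝ) = 2 ^ 3 by norm_num, Real.log_pow]
        push_cast
        linarith [Real.log_two_gt_d9]
    _ ≤ _ := Real.log_le_log (by norm_num) h8

/-- The choice of the parameters in the almost periodicity argument. -/
lemma exists_parameters {α K : ℝ} (hα0 : 0 < α) (hα1 : α ≤ 1) (hK : 2 ≤ K) {k : ℕ}
    (hk : (k : ℝ) ≤ 25 * Real.log (4 / (α / K))) :
    ∃ (q l : ℕ) (δ : ℝ), 1 ≤ q ∧ 0 ≤ δ ∧ 64 * (k : ℝ) ^ 2 ≤ δ ^ 2 * q ∧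
      2 * (8 * l * δ + 3 * α⁻¹ / 4 ^ l) ≤ (K⁻¹ ^ 3 / 16) / 2 ∧
      8 * (q * Real.log (2 / α) + 1) ≤ 10 ^ 14 * Real.log (4 / (α / K)) ^ 5 * K ^ 6 := by
  set L := Real.log (4 / (α / K)) with hL
  have hL2 : 2 ≤ L := two_le_log_four_div hα0 hα1 hK
  have hK0 : 0 < K := by linarith
  have hexpL : Real.exp L = 4 * K / α := by
    rw [hL, Real.exp_log (by positivity)]; field_simp
  -- Then `4 ^ l ≥ exp(4L) = (4K/α)⁴`, which outweighs the factor `α⁻¹` and a power of `K`.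
  set l := ⌈4 * L⌉₊ with hl
  have hl1 : 4 * L ≤ l := Nat.le_ceil _
  have hl2 : (l : ℝ) ≤ 5 * L := by
    have := (Nat.ceil_lt_add_one (by linarith : 0 ≤ 4 * L)).le
    linarith
  have hl0 : (0 : ℝ) < l := by linarith
  -- Chosen so that `8lδ = K⁻³/128`. The sample size `q` is then about `k² l² K⁶`, so the
  -- codimension is of order `L⁵ K⁶`.
  set δ : ℝ := 1 / (1024 * l * K ^ 3) with hδ
  have hδ0 : 0 < δ := by positivity
  set Q : ℝ := 64 * (k : ℝ) ^ 2 / δ ^ 2 + 1 with hQ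
  have hQ0 : 0 ≤ 64 * (k : ℝ) ^ 2 / δ ^ 2 := by positivity
  refine ⟨⌈Q⌉₊, l, δ, Nat.one_le_ceil_iff.2 (by linarith), hδ0.le, ?_, ?_, ?_⟩
  · have : Q ≤ ⌈Q⌉₊ := Nat.le_ceil _
    calc 64 * (k : ℝ) ^ 2 = δ ^ 2 * (64 * (k : ℝ) ^ 2 / δ ^ 2) := by field_simp
      _ ≤ δ ^ 2 * ⌈Q⌉₊ := by gcongr; linarith
  · have h4 : 512 * K ^ 3 / α ≤ (4 : ℝ) ^ l := by
      have h1 : Real.exp (4 * L) ≤ (4 : ℝ) ^ l := by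
        calc Real.exp (4 * L) ≤ Real.exp l := Real.exp_le_exp.2 hl1
          _ = Real.exp 1 ^ l := by rw [← Real.exp_nat_mul, mul_one]
          _ ≤ 4 ^ l := by
              gcongr
              linarith [Real.exp_one_lt_d9]
      refine le_trans ?_ h1
      rw [show 4 * L = ((4 : ℕ) : ℝ) * L by norm_num, Real.exp_nat_mul, hexpL, div_pow,
        div_le_div_iff₀ hα0 (by positivity)]
      have hα4 : α ^ 4 ≤ α := by
        calc α ^ 4 ≤ α ^ 1 := pow_le_pow_of_le_one hα0.le hα1 (by norm_num)
          _ = α := pow_one α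
      calc 512 * K ^ 3 * α ^ 4 ≤ 512 * K ^ 3 * α := by gcongr
        _ ≤ (4 * K) ^ 4 * α := by
            gcongr
            nlinarith [pow_pos hK0 3]
    have h5 : 3 * α⁻¹ / 4 ^ l ≤ K⁻¹ ^ 3 * (3 / 512) := by
      rw [div_le_iff₀ (by positivity)]
      calc 3 * α⁻¹ = K⁻¹ ^ 3 * (3 / 512) * (512 * K ^ 3 / α) := by field_simp
        _ ≤ _ := by gcongr
    have h6 : 8 * l * δ = K⁻¹ ^ 3 / 128 := by
      rw [hδ]; field_simp; norm_num
    have : 0 < K⁻¹ ^ 3 := by positivity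
    rw [h6]
    linarith
  · have hlogle : Real.log (2 / α) ≤ L := by
      refine Real.log_le_log (by positivity) ?_
      rw [div_le_div_iff₀ hα0 (by positivity), mul_div_assoc', div_le_iff₀ hK0]
      nlinarith
    have hlog0 : 0 ≤ Real.log (2 / α) :=
      Real.log_nonneg (by rw [le_div_iff₀ hα0]; linarith)
    have hq : (⌈Q⌉₊ : ℝ) ≤ 64 * (k : ℝ) ^ 2 / δ ^ 2 + 2 := by
      have := (Nat.ceil_lt_add_one (by positivity : 0 ≤ Q)).le
      linarith
    have hK6 : 1 ≤ K ^ 6 := one_le_pow₀ (by linarith)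
    have hL4 : 1 ≤ L ^ 4 := one_le_pow₀ (by linarith)
    have hQle : 64 * (k : ℝ) ^ 2 / δ ^ 2 ≤ 1048576000000 * (L ^ 4 * K ^ 6) := by
      calc 64 * (k : ℝ) ^ 2 / δ ^ 2 = 64 * 1024 ^ 2 * ((k : ℝ) ^ 2 * l ^ 2) * K ^ 6 := by
            rw [hδ]; field_simp
        _ ≤ 64 * 1024 ^ 2 * ((25 * L) ^ 2 * (5 * L) ^ 2) * K ^ 6 := by gcongr
        _ = 1048576000000 * (L ^ 4 * K ^ 6) := by ring
    have hLK : 1 ≤ L ^ 4 * K ^ 6 := by nlinarith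
    calc 8 * (⌈Q⌉₊ * Real.log (2 / α) + 1)
        ≤ 8 * ((1048576000000 * (L ^ 4 * K ^ 6) + 2) * L + 1) := by gcongr; linarith
      _ ≤ 8 * ((1048576000000 * (L ^ 4 * K ^ 6) + 2 * (L ^ 4 * K ^ 6)) * L +
            (L ^ 4 * K ^ 6) * L) := by
          gcongr
          · linarith
          · nlinarith
      _ = 8388608000024 * (L ^ 5 * K ^ 6) := by ring
      _ ≤ 10 ^ 14 * (L ^ 5 * K ^ 6) := by
          gcongr; norm_num
      _ = _ := by ring

end SpectralBoosting

/-! ### Exponential sums over `X` and `H`, and the counts they encode. -/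

namespace SpectralBoosting

open Finset
open scoped ComplexConjugate

variable {p : ℕ} [Fact p.Prime] {n : ℕ}

/-- The exponential sum over a finite set of frequencies. -/
noncomputable def expSum (S : Finset (Fin n → ZMod p)) (x : Fin n → ZMod p) : ℂ :=
  ∑ γ ∈ S, chi γ x

lemma chi_add_left (γ γ' x : Fin n → ZMod p) : chi (γ + γ') x = chi γ x * chi γ' x := by
  rw [← chiHom_apply, map_add]; rfl

lemma chi_neg_left (γ x : Fin n → ZMod p) : chi (-γ) x = conj (chi γ x) := by
  rw [← AddChar.map_neg_eq_conj, chi_apply, chi_apply, neg_dotProduct, dotProduct_neg]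

lemma chi_sub_left (γ γ' x : Fin n → ZMod p) : chi (γ - γ') x = chi γ x * conj (chi γ' x) := by
  rw [sub_eq_add_neg, chi_add_left, chi_neg_left]

lemma chi_sum_left {ι : Type*} (s : Finset ι) (f : ι → Fin n → ZMod p) (x : Fin n → ZMod p) :
    chi (∑ i ∈ s, f i) x = ∏ i ∈ s, chi (f i) x := by
  rw [← chiHom_apply, map_sum, AddChar.sum_apply]; rfl

lemma expect_re_chi (γ : Fin n → ZMod p) : 𝔼 x, (chi γ x).re = if γ = 0 then 1 else 0 := by
  rw [← re_expect, expect_chi]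
  split_ifs <;> simp

lemma norm_sq_sum_chi {ι : Type*} (s : Finset ι) (f : ι → Fin n → ZMod p) (x : Fin n → ZMod p) :
    ((‖∑ i ∈ s, chi (f i) x‖ : ℂ)) ^ 2 = ∑ i ∈ s, ∑ j ∈ s, chi (f i - f j) x := by
  rw [← Complex.mul_conj', map_sum, Finset.sum_mul_sum]
  simp_rw [chi_sub_left]

lemma expect_norm_expSum_pow (X : Finset (Fin n → ZMod p)) (m : ℕ) :
    𝔼 x, ‖expSum X x‖ ^ (2 * m) = energy m X := by
  have h : ∀ x, ‖expSum X x‖ ^ (2 * m) =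
      ∑ a ∈ Fintype.piFinset fun _ : Fin m => X, ∑ b ∈ Fintype.piFinset fun _ : Fin m => X,
        (chi (∑ i, a i - ∑ i, b i) x).re := by
    intro x
    have h1 : expSum X x ^ m =
        ∑ a ∈ Fintype.piFinset fun _ : Fin m => X, chi (∑ i, a i) x := by
      rw [expSum, Finset.sum_pow']
      exact Finset.sum_congr rfl fun a _ => (chi_sum_left _ _ _).symm
    have h2 := norm_sq_sum_chi (Fintype.piFinset fun _ : Fin m => X) (fun a => ∑ i, a i) x
    rw [← h1, norm_pow] at h2
    have h3 := congrArg Complex.re h2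
    rw [← Complex.ofReal_pow, Complex.ofReal_re, ← pow_mul, mul_comm] at h3
    rw [h3, Complex.re_sum]
    exact Finset.sum_congr rfl fun a _ => Complex.re_sum _ _
  simp_rw [h]
  rw [Finset.expect_sum_comm]
  simp_rw [Finset.expect_sum_comm, expect_re_chi, sub_eq_zero]
  rw [energy, Finset.card_filter, Finset.sum_product]
  push_cast
  rfl

/-- The normalised squared modulus of an exponential sum. -/
noncomputable def expWeight (H : Finset (Fin n → ZMod p)) (x : Fin n → ZMod p) : ℝ :=
  ‖expSum H x‖ ^ 2 / #H

lemma norm_expSum_sq (H : Finset (Fin n → ZMod p)) (x : Fin n → ZMod p) :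
    ((‖expSum H x‖ : ℂ)) ^ 2 = ∑ h ∈ H, ∑ h' ∈ H, chi (h - h') x :=
  norm_sq_sum_chi H id x

lemma expWeight_nonneg (H : Finset (Fin n → ZMod p)) (x : Fin n → ZMod p) : 0 ≤ expWeight H x := by
  unfold expWeight; positivity

lemma expWeight_le (H : Finset (Fin n → ZMod p)) (x : Fin n → ZMod p) : expWeight H x ≤ #H := by
  have h : ‖expSum H x‖ ≤ #H := by
    refine (norm_sum_le _ _).trans ?_
    simp [AddChar.norm_apply]
  unfold expWeight
  refine div_le_of_le_mul₀ (by positivity) (by positivity) ?_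
  rw [← sq]
  gcongr

lemma expWeight_mul_re_expSum (H X : Finset (Fin n → ZMod p)) (x : Fin n → ZMod p) :
    expWeight H x * (expSum X x).re =
      (∑ h ∈ H, ∑ h' ∈ H, ∑ γ ∈ X, (chi (h - h' + γ) x).re) / #H := by
  rw [expWeight, div_mul_eq_mul_div]
  congr 1
  rw [← Complex.re_ofReal_mul]
  push_cast
  rw [norm_expSum_sq, expSum, Finset.sum_mul, Complex.re_sum]
  refine Finset.sum_congr rfl fun h _ => ?_
  rw [Finset.sum_mul, Complex.re_sum]
  refine Finset.sum_congr rfl fun h' _ => ?_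
  rw [Finset.mul_sum, Complex.re_sum]
  exact Finset.sum_congr rfl fun γ _ => by rw [chi_add_left]

lemma expect_expWeight {H : Finset (Fin n → ZMod p)} (hH : H.Nonempty) :
    𝔼 x, expWeight H x = 1 := by
  have h0 : (#H : ℝ) ≠ 0 := by exact_mod_cast hH.card_pos.ne'
  have h : ∀ x, expWeight H x = (∑ h ∈ H, ∑ h' ∈ H, (chi (h - h') x).re) / #H := by
    intro x
    have := expWeight_mul_re_expSum H {0} x
    have h1 : expSum ({0} : Finset (Fin n → ZMod p)) x = 1 := by
      rw [expSum, sum_singleton, chi_apply_eq_one_iff, zero_dotProduct]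
    simpa [h1] using this
  simp_rw [h]
  rw [← Finset.expect_div, Finset.expect_sum_comm]
  simp_rw [Finset.expect_sum_comm, expect_re_chi, sub_eq_zero]
  simp [h0]

/-- For each of the `|H|²` pairs `h, h'`, at most one `γ ∈ X` satisfies `h - h' + γ = 0`. This is
the main term that the correlation has to beat. -/
lemma expect_expWeight_mul_re_expSum_le {H : Finset (Fin n → ZMod p)} (hH : H.Nonempty)
    (X : Finset (Fin n → ZMod p)) :
    𝔼 x, expWeight H x * (expSum X x).re ≤ #H := by
  have h0 : (0 : ℝ) < #H := by exact_mod_cast hH.card_pos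
  simp_rw [expWeight_mul_re_expSum]
  rw [← Finset.expect_div, Finset.expect_sum_comm, div_le_iff₀ h0]
  simp_rw [Finset.expect_sum_comm, expect_re_chi]
  calc _ ≤ ∑ h ∈ H, ∑ h' ∈ H, (1 : ℝ) := by
        refine Finset.sum_le_sum fun h _ => Finset.sum_le_sum fun h' _ => ?_
        have : ∀ γ : Fin n → ZMod p, h - h' + γ = 0 ↔ γ = h' - h := fun γ => by
          rw [add_eq_zero_iff_eq_neg', neg_sub]
        simp_rw [this, Finset.sum_ite_eq']
        split_ifs <;> norm_num
    _ = _ := by simp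

lemma expWeight_add_of_mem_perp {H : Finset (Fin n → ZMod p)} {w : Fin n → ZMod p}
    (hw : w ∈ perp H) (x : Fin n → ZMod p) : expWeight H (x + w) = expWeight H x := by
  unfold expWeight expSum
  congr 3
  refine Finset.sum_congr rfl fun h hh => ?_
  rw [AddChar.map_add_eq_mul, (chi_apply_eq_one_iff h w).2 (mem_perp.1 hw h hh), mul_one]

/-- The number of `(h, h', γ) ∈ H × H × X` with `h - h' + γ ∈ X`. -/
noncomputable def shiftCount (H X : Finset (Fin n → ZMod p)) : ℝ :=
  ∑ h ∈ H, ∑ h' ∈ H, ∑ γ ∈ X, if h - h' + γ ∈ X then 1 else 0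

/-- The inner product counts pairs from `X` and from `H` with a common difference; a change of
variables eliminates one element of `X`. -/
lemma dualInner_dualCirc_eq (X H : Finset (Fin n → ZMod p)) :
    dualInner (dualCirc (ind (X : Set (Fin n → ZMod p))) (ind (X : Set (Fin n → ZMod p))))
      (dualCirc (ind (H : Set (Fin n → ZMod p))) (ind (H : Set (Fin n → ZMod p)))) =
      shiftCount H X := by
  have hH : ∀ F : (Fin n → ZMod p) → ℝ, ∑ h ∈ H, F h = ∑ h, ind (H : Set _) h * F h := fun F => by
    simp [ind_coe_eq_ite]
  have hX : ∀ F : (Fin n → ZMod p) → ℝ, ∑ h ∈ X, F h = ∑ h, ind (X : Set _) h * F h := fun F => by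
    simp [ind_coe_eq_ite]
  simp only [dualInner, dualCirc, shiftCount, ← ind_coe_eq_ite X, hH, hX]
  simp_rw [Finset.mul_sum, Finset.sum_mul]
  rw [Finset.sum_comm]
  refine Finset.sum_congr rfl fun μ _ => ?_
  rw [← Equiv.sum_comp (Equiv.subLeft μ)]
  refine Finset.sum_congr rfl fun h' _ => ?_
  rw [← Equiv.sum_comp (Equiv.addLeft (μ - h'))]
  refine Finset.sum_congr rfl fun γ _ => ?_
  simp only [Equiv.subLeft_apply, Equiv.coe_addLeft, add_sub_cancel_left, sub_sub_cancel]
  ring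

lemma expect_expWeight_mul_norm_sq (H X : Finset (Fin n → ZMod p)) :
    𝔼 x, expWeight H x * ‖expSum X x‖ ^ 2 = shiftCount H X / #H := by
  have h : ∀ x, expWeight H x * ‖expSum X x‖ ^ 2 =
      (∑ h ∈ H, ∑ h' ∈ H, ∑ γ ∈ X, ∑ γ' ∈ X, (chi (h - h' + γ - γ') x).re) / #H := by
    intro x
    rw [expWeight, div_mul_eq_mul_div]
    congr 1
    rw [← Complex.ofReal_re (‖expSum H x‖ ^ 2 * ‖expSum X x‖ ^ 2)]
    push_cast
    rw [norm_expSum_sq, norm_expSum_sq, Finset.sum_mul, Complex.re_sum]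
    refine Finset.sum_congr rfl fun h _ => ?_
    rw [Finset.sum_mul, Complex.re_sum]
    refine Finset.sum_congr rfl fun h' _ => ?_
    rw [Finset.mul_sum, Complex.re_sum]
    refine Finset.sum_congr rfl fun γ _ => ?_
    rw [Finset.mul_sum, Complex.re_sum]
    refine Finset.sum_congr rfl fun γ' _ => ?_
    rw [add_sub_assoc, chi_add_left]
  simp_rw [h]
  rw [← Finset.expect_div, Finset.expect_sum_comm]
  simp_rw [Finset.expect_sum_comm, expect_re_chi, sub_eq_zero, Finset.sum_ite_eq]
  rfl

lemma expect_expect_mul_chi (a : (Fin n → ZMod p) → ℝ) (γ : Fin n → ZMod p) :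
    𝔼 y, 𝔼 x, a y * a x * (chi γ (x - y)).re = ‖coeff a (chi γ)‖ ^ 2 := by
  have h : ((‖coeff a (chi γ)‖ : ℂ)) ^ 2 = 𝔼 y, 𝔼 x, ((a y * a x : ℝ) : ℂ) * chi γ (x - y) := by
    rw [← Complex.conj_mul', coeff, map_expect, Finset.expect_mul_expect]
    refine Finset.expect_congr rfl fun y _ => Finset.expect_congr rfl fun x _ => ?_
    rw [map_mul, Complex.conj_ofReal, sub_eq_add_neg, AddChar.map_add_eq_mul,
      AddChar.map_neg_eq_conj]
    push_cast
    ring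
  have h' := congrArg Complex.re h
  rw [← Complex.ofReal_pow, Complex.ofReal_re, re_expect] at h'
  rw [h']
  refine Finset.expect_congr rfl fun y _ => ?_
  rw [re_expect]
  exact Finset.expect_congr rfl fun x _ => by rw [Complex.re_ofReal_mul]

/-- The pairing expands into the non-negative terms `|â(h - h' + γ)|² / |H|`; only those whose
frequency returns to `X` are kept. -/
lemma le_expect_expect_mul_expWeight {a : (Fin n → ZMod p) → ℝ} {η : ℝ} (hη : 0 ≤ η)
    {X H : Finset (Fin n → ZMod p)} (hX : ∀ γ ∈ X, η ≤ ‖coeff a (chi γ)‖) :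
    η ^ 2 * (shiftCount H X / #H) ≤
      𝔼 y, 𝔼 x, a y * a x * (expWeight H (x - y) * (expSum X (x - y)).re) := by
  simp_rw [expWeight_mul_re_expSum, mul_div_assoc', ← Finset.expect_div, Finset.mul_sum,
    Finset.expect_sum_comm, expect_expect_mul_chi]
  gcongr
  rw [shiftCount, Finset.mul_sum]
  refine Finset.sum_le_sum fun h _ => ?_
  rw [Finset.mul_sum]
  refine Finset.sum_le_sum fun h' _ => ?_
  rw [Finset.mul_sum]
  refine Finset.sum_le_sum fun γ _ => ?_
  split_ifs with hmem
  · rw [mul_one]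
    gcongr
    exact hX _ hmem
  · rw [mul_zero]; positivity

lemma card_mul_sq_le_expect_sq {a : (Fin n → ZMod p) → ℝ} {η : ℝ} (hη : 0 ≤ η)
    {X : Finset (Fin n → ZMod p)} (hX : ∀ γ ∈ X, η ≤ ‖coeff a (chi γ)‖) :
    #X * η ^ 2 ≤ 𝔼 x, a x ^ 2 := by
  classical
  rw [expect_sq_eq_sum_normSq_coeff]
  calc #X * η ^ 2 = ∑ ψ ∈ X.image chi, η ^ 2 := by
        rw [sum_const, card_image_of_injective _ chi_injective, nsmul_eq_mul]
    _ ≤ ∑ ψ ∈ X.image chi, ‖coeff a ψ‖ ^ 2 := by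
        refine Finset.sum_le_sum fun ψ hψ => ?_
        obtain ⟨γ, hγ, rfl⟩ := mem_image.1 hψ
        have := hX γ hγ
        gcongr
    _ ≤ _ := Finset.sum_le_sum_of_subset_of_nonneg (subset_univ _) fun _ _ _ => by positivity

/-- Given `h` and `γ`, the map `h' ↦ h - h' + γ` is injective into `X`. -/
lemma shiftCount_le (H X : Finset (Fin n → ZMod p)) : shiftCount H X ≤ #X ^ 2 * #H := by
  rw [shiftCount]
  calc ∑ h ∈ H, ∑ h' ∈ H, ∑ γ ∈ X, (if h - h' + γ ∈ X then (1 : ℝ) else 0)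
      = ∑ h ∈ H, ∑ γ ∈ X, ∑ h' ∈ H, (if h - h' + γ ∈ X then (1 : ℝ) else 0) :=
        Finset.sum_congr rfl fun h _ => Finset.sum_comm
    _ ≤ ∑ h ∈ H, ∑ γ ∈ X, (#X : ℝ) := by
        refine Finset.sum_le_sum fun h _ => Finset.sum_le_sum fun γ _ => ?_
        rw [← Finset.sum_filter, sum_const, nsmul_eq_mul, mul_one]
        norm_cast
        refine Finset.card_le_card_of_injOn (fun h' => h - h' + γ)
          (fun h' hh' => (mem_filter.1 hh').2) fun u _ v _ huv => ?_
        simpa using huv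
    _ = _ := by simp; ring

end SpectralBoosting

/-! ### The hyperplane case and localisation to cosets. -/

namespace SpectralBoosting

open Finset
open scoped ComplexConjugate

variable {p : ℕ} [Fact p.Prime] {n : ℕ}

lemma norm_fourier (f : (Fin n → ZMod p) → ℝ) (γ : Fin n → ZMod p) :
    ‖fourier f γ‖ = ‖coeff f (chi γ)‖ := by
  rw [← Complex.norm_conj, fourier, map_expect, coeff]
  congr 1
  refine Finset.expect_congr rfl fun x _ => ?_
  rw [map_mul, Complex.conj_ofReal, Complex.conj_conj, chi_apply]

lemma density_coe {G : Type*} [Fintype G] (S : Finset G) :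
    density (S : Set G) = (#S : ℝ) / Fintype.card G := by
  rw [density, Set.ncard_coe_finset]

lemma lpNorm_one_ind {G : Type*} [Fintype G] (S : Finset G) :
    lpNorm 1 (ind (S : Set G)) = density (S : Set G) := by
  simp only [lpNorm, Real.rpow_one, div_one, abs_of_nonneg (ind_nonneg _ _)]
  rw [expect_ind, density_coe]

lemma coeff_const_mul (c : ℝ) (f : (Fin n → ZMod p) → ℝ) (ψ : AddChar (Fin n → ZMod p) ℂ) :
    coeff (fun x => c * f x) ψ = c * coeff f ψ := by
  rw [coeff, coeff, Finset.mul_expect]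
  exact Finset.expect_congr rfl fun x _ => by push_cast; ring

lemma le_norm_coeff_of_mem_largeSpectrum {A : Finset (Fin n → ZMod p)} (hA : A.Nonempty) {η : ℝ}
    {γ : Fin n → ZMod p} (hγ : γ ∈ largeSpectrum η (ind (A : Set (Fin n → ZMod p)))) :
    η ≤ ‖coeff (mu (A : Set (Fin n → ZMod p))) (chi γ)‖ := by
  have hpos : 0 < density (A : Set (Fin n → ZMod p)) := by
    rw [density_coe]
    have : 0 < #A := hA.card_pos
    have : 0 < Fintype.card (Fin n → ZMod p) := Fintype.card_pos
    positivity
  have h : η * lpNorm 1 (ind (A : Set (Fin n → ZMod p))) ≤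
    ‖fourier (ind (A : Set (Fin n → ZMod p))) γ‖ := hγ
  rw [lpNorm_one_ind, norm_fourier] at h
  have hmu : mu (A : Set (Fin n → ZMod p)) =
    fun x => (density (A : Set (Fin n → ZMod p)))⁻¹ * ind (A : Set (Fin n → ZMod p)) x := rfl
  rw [hmu, coeff_const_mul, norm_mul, Complex.norm_real, norm_inv, Real.norm_eq_abs,
    abs_of_pos hpos, inv_mul_eq_div, le_div_iff₀ hpos]
  exact h

lemma conv_mu_submodule (a : (Fin n → ZMod p) → ℝ) (W : Submodule (ZMod p) (Fin n → ZMod p)) :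
    conv a (mu (W : Set (Fin n → ZMod p))) = finAvg (elems W) a := by
  have hcoe : (W : Set (Fin n → ZMod p)) = (elems W : Set (Fin n → ZMod p)) := by
    ext x; simp [mem_elems]
  have h1 : (0 : ℝ) < #(elems W) := by exact_mod_cast (elems_nonempty W).card_pos
  have h2 : (0 : ℝ) < Fintype.card (Fin n → ZMod p) := by exact_mod_cast Fintype.card_pos
  funext x
  simp only [conv, mu]
  rw [hcoe, ← expect_sub_left _ x]
  simp only [sub_sub_cancel]
  calc 𝔼 z, a (x - z) * ((density (elems W : Set (Fin n → ZMod p)))⁻¹ *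
        ind (elems W : Set (Fin n → ZMod p)) z)
      = (density (elems W : Set (Fin n → ZMod p)))⁻¹ *
        𝔼 z, ind (elems W : Set (Fin n → ZMod p)) z * a (x - z) := by
        rw [Finset.mul_expect]
        exact Finset.expect_congr rfl fun z _ => by ring
    _ = 𝔼 v : elems W, a (x - v.1) := by
        rw [expect_ind_mul _ (elems_nonempty W) (fun z => a (x - z)), density_coe, ← mul_assoc,
          inv_mul_cancel₀ (by positivity), one_mul]
    _ = _ := by
        rw [finAvg, ← expect_elems_neg W (fun v => a (x + v))]
        simp [sub_eq_add_neg]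

lemma le_supNorm {G : Type*} [Finite G] (f : G → ℝ) (x : G) : f x ≤ supNorm f :=
  (le_abs_self _).trans (le_ciSup (f := fun x => |f x|) (Set.finite_range _).bddAbove x)

/-- A single nontrivial Fourier coefficient yields a density increment on a hyperplane. -/
lemma exists_hyperplane_increment {a : (Fin n → ZMod p) → ℝ} (ha : 𝔼 x, a x = 1) {η : ℝ}
    {γ : Fin n → ZMod p} (hγ0 : γ ≠ 0) (hη : 0 < η) (hγ : η ≤ ‖coeff a (chi γ)‖) :
    ∃ x, 1 + η / 2 ≤ finAvg (elems (perp {γ})) a x := by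
  set W := perp {γ} with hW
  have hne : Nonempty (elems W) := (elems_nonempty W).to_subtype
  set F := fun x => finAvg (elems W) a x - 1 with hF
  have hFc : coeff F (chi γ) = coeff a (chi γ) := by
    rw [hF, coeff_sub, coeff_finAvg]
    have h1 : unifCoeff (elems W) (chi γ) = 1 := by
      rw [unifCoeff, Finset.expect_congr rfl (fun v _ => (chi_apply_eq_one_iff γ v.1).2
        (mem_perp.1 (mem_elems.1 v.2) γ (mem_singleton_self γ)))]
      exact Fintype.expect_const _
    have h2 : coeff (fun _ => (1 : ℝ)) (chi γ) = 0 := by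
      simp [coeff, expect_chi, hγ0]
    rw [h1, h2]; simp
  have hFmean : 𝔼 x, F x = 0 := by
    rw [hF, Finset.expect_sub_distrib, expect_finAvg, ha, Fintype.expect_const, sub_self]
  have hFabs : η ≤ 𝔼 x, |F x| := by
    rw [← hFc] at hγ
    refine hγ.trans ((RCLike.norm_expect_le (K := ℂ)).trans (le_of_eq ?_))
    refine Finset.expect_congr rfl fun x _ => ?_
    rw [norm_mul, AddChar.norm_apply, mul_one, Complex.norm_real, Real.norm_eq_abs]
  -- `F` has mean zero, so adding it costs nothing; a point where `|F| + F ≥ η` has `F ≥ η/2`, with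
  -- the right sign.
  have hsum : η ≤ 𝔼 x, (|F x| + F x) := by
    rw [Finset.expect_add_distrib, hFmean, add_zero]; exact hFabs
  obtain ⟨x, -, hx⟩ := Finset.exists_le_of_le_expect univ_nonempty hsum
  refine ⟨x, ?_⟩
  have hx' : finAvg (elems W) a x = F x + 1 := by rw [hF]; ring
  rw [hx']
  rcases le_total 0 (F x) with h | h
  · rw [abs_of_nonneg h] at hx; linarith
  · rw [abs_of_nonpos h] at hx; linarith

/-- A maximal independent subset of `H` has the same span, hence the same annihilator. -/
lemma finrank_quotient_perp_le_linDim (H : Finset (Fin n → ZMod p)) :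
    Module.finrank (ZMod p) ((Fin n → ZMod p) ⧸ perp H) ≤ linDim H := by
  classical
  obtain ⟨Λ', hsub, hspan, hind⟩ := exists_linearIndependent (ZMod p)
    (H : Set (Fin n → ZMod p))
  set Λ := Λ'.toFinite.toFinset with hΛ
  have hcoe : (Λ : Set (Fin n → ZMod p)) = Λ' := by simp [hΛ]
  have hperp : perp Λ = perp H := by
    ext x
    rw [mem_perp, mem_perp]
    constructor
    · intro h γ hγ
      have hmem : γ ∈ Submodule.span (ZMod p) Λ' := by
        rw [hspan]; exact Submodule.subset_span hγ
      refine dotProduct_eq_zero_of_mem_span hmem fun γ' hγ' => h γ' ?_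
      have : γ' ∈ (Λ : Set _) := by rw [hcoe]; exact hγ'
      exact this
    · intro h γ hγ
      have : γ ∈ (Λ : Set _) := hγ
      rw [hcoe] at this
      exact h γ (hsub this)
  rw [← hperp]
  refine (finrank_quotient_perp_le Λ).trans ?_
  unfold linDim
  refine Finset.le_sup (f := Finset.card) (mem_filter.2 ⟨mem_powerset.2 ?_, ?_⟩)
  · rw [← Finset.coe_subset, hcoe]; exact hsub
  · rw [hcoe]; exact hind

/-- Identifies `perp H` with some `𝔽_p^d`, so that the increment argument can be run inside its
cosets. -/
lemma exists_linear_parametrization (W : Submodule (ZMod p) (Fin n → ZMod p)) :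
    ∃ (d : ℕ) (ι : (Fin d → ZMod p) →ₗ[ZMod p] (Fin n → ZMod p)),
      Function.Injective ι ∧ LinearMap.range ι = W := by
  let b := Module.finBasis (ZMod p) W
  refine ⟨_, W.subtype ∘ₗ b.equivFun.symm.toLinearMap, ?_, ?_⟩
  · exact W.injective_subtype.comp b.equivFun.symm.injective
  · rw [LinearMap.range_comp, LinearEquiv.range, Submodule.map_top, Submodule.range_subtype]

lemma finrank_quotient_map {d : ℕ} (ι : (Fin d → ZMod p) →ₗ[ZMod p] (Fin n → ZMod p))
    (hι : Function.Injective ι) (V : Submodule (ZMod p) (Fin d → ZMod p)) :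
    Module.finrank (ZMod p) ((Fin n → ZMod p) ⧸ V.map ι) =
      Module.finrank (ZMod p) ((Fin n → ZMod p) ⧸ LinearMap.range ι) +
        Module.finrank (ZMod p) ((Fin d → ZMod p) ⧸ V) := by
  have h1 := Submodule.finrank_quotient_add_finrank (V.map ι)
  have h2 := Submodule.finrank_quotient_add_finrank (LinearMap.range ι)
  have h3 := Submodule.finrank_quotient_add_finrank V
  have h4 : Module.finrank (ZMod p) (V.map ι) = Module.finrank (ZMod p) V :=
    (Submodule.equivMapOfInjective ι hι V).finrank_eq.symm
  have h5 : Module.finrank (ZMod p) (LinearMap.range ι) =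
    Module.finrank (ZMod p) (Fin d → ZMod p) := LinearMap.finrank_range_of_inj hι
  omega

lemma finAvg_map {d : ℕ} (ι : (Fin d → ZMod p) →ₗ[ZMod p] (Fin n → ZMod p))
    (hι : Function.Injective ι) (V : Submodule (ZMod p) (Fin d → ZMod p))
    (F : (Fin n → ZMod p) → ℝ) (u : Fin n → ZMod p) (y : Fin d → ZMod p) :
    finAvg (elems V) (fun x => F (u + ι x)) y = finAvg (elems (V.map ι)) F (u + ι y) := by
  refine Fintype.expect_bijective
    (fun v : elems V => (⟨ι v.1, mem_elems.2 (Submodule.mem_map_of_mem (mem_elems.1 v.2))⟩ :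
      elems (V.map ι))) ⟨?_, ?_⟩ _ _ fun v => ?_
  · intro v v' h
    exact Subtype.ext (hι (congrArg Subtype.val h))
  · rintro ⟨w, hw⟩
    obtain ⟨v, hv, rfl⟩ := Submodule.mem_map.1 (mem_elems.1 hw)
    exact ⟨⟨v, mem_elems.2 hv⟩, rfl⟩
  · simp only [map_add, add_assoc]

lemma expect_map_eq_finAvg {d : ℕ} (ι : (Fin d → ZMod p) →ₗ[ZMod p] (Fin n → ZMod p))
    (hι : Function.Injective ι) (F : (Fin n → ZMod p) → ℝ) (u : Fin n → ZMod p) :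
    𝔼 x, F (u + ι x) = finAvg (elems (LinearMap.range ι)) F u := by
  refine Fintype.expect_bijective
    (fun x => (⟨ι x, mem_elems.2 (LinearMap.mem_range_self ι x)⟩ :
      elems (LinearMap.range ι))) ⟨?_, ?_⟩ _ _ fun v => rfl
  · intro v v' h
    exact hι (congrArg Subtype.val h)
  · rintro ⟨w, hw⟩
    obtain ⟨v, rfl⟩ := LinearMap.mem_range.1 (mem_elems.1 hw)
    exact ⟨v, rfl⟩

/-- Localisation to a pair of cosets: a correlation of `a ∘ a` with `g` weighted by `ν` is
inherited by the restrictions to suitable translates of the range of `ι`. -/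
lemma exists_correlated_cosets {G D : Type*} [AddCommGroup G] [Fintype G] [AddCommGroup D]
    [Fintype D] (ι : D →+ G) {a ν g : G → ℝ} {c κ E : ℝ} {k : ℕ} (hk : 1 ≤ k)
    (ha : 𝔼 x, a x = 1) (hν0 : ∀ x, 0 ≤ ν x) (hν1 : 𝔼 x, ν x = 1)
    (hνι : ∀ x z, ν (x + ι z) = ν x) (hc : 0 ≤ c) (hκ : 0 ≤ κ) (hE : 0 ≤ E)
    (hg : 𝔼 x, ν x * g x ^ (2 * k) ≤ E ^ (2 * k))
    (hcorr : 𝔼 x, ν x * g x + (c + 36 * κ) * E <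
      𝔼 y, 𝔼 x, a y * a x * (ν (x - y) * g (x - y))) :
    ∃ (s u : G) (N : ℝ), 0 ≤ N ∧ 𝔼 x, g (s + ι x) ^ (2 * k) ≤ N ^ (2 * k) ∧
      (c + 18 * ((1 + κ - 𝔼 x, a (u + s + ι x)) + (1 + κ - 𝔼 x, a (u + ι x)))) * N <
        (𝔼 y, 𝔼 x, a (u + ι y) * a (u + s + ι x) * g (s + ι (x - y))) - 𝔼 x, g (s + ι x) := by
  have hG : Nonempty G := ⟨0⟩
  have hD : Nonempty D := ⟨0⟩
  have hex : ∀ s, ∃ N : ℝ, 0 ≤ N ∧ N ^ (2 * k) = 𝔼 x, g (s + ι x) ^ (2 * k) := by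
    intro s
    have h0 : 0 ≤ 𝔼 x, g (s + ι x) ^ (2 * k) :=
      expect_nonneg fun x _ => (even_two_mul k).pow_nonneg _
    refine ⟨(𝔼 x, g (s + ι x) ^ (2 * k)) ^ (((2 * k : ℕ) : ℝ)⁻¹), Real.rpow_nonneg h0 _, ?_⟩
    exact Real.rpow_inv_natCast_pow h0 (by omega)
  choose N hN0 hNp using hex
  have hshift : ∀ F : G → ℝ, 𝔼 s, 𝔼 x, F (s + ι x) = 𝔼 s, F s := by
    intro F
    rw [Finset.expect_comm]
    simp_rw [expect_add_right]
    exact Fintype.expect_const _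
  -- `N s` is the `L^{2k}` norm of `g` on the coset of `s`; by Jensen the `ν`-average of these norms
  -- is at most the global norm.
  have hNE : 𝔼 s, ν s * N s ≤ E := by
    refine le_of_pow_le_pow_left₀ (n := 2 * k) (by omega) hE ?_
    refine (pow_expect_mul_le ν N hν0 hk).trans ?_
    rw [hν1, one_pow, one_mul]
    refine le_trans (le_of_eq ?_) hg
    rw [← hshift (fun x => ν x * g x ^ (2 * k))]
    refine Finset.expect_congr rfl fun s _ => ?_
    simp_rw [hνι]
    rw [← Finset.mul_expect, hNp]
  have hM : 𝔼 s, ν s * 𝔼 x, g (s + ι x) = 𝔼 x, ν x * g x := by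
    rw [← hshift (fun x => ν x * g x)]
    refine Finset.expect_congr rfl fun s _ => ?_
    simp_rw [hνι]
    rw [← Finset.mul_expect]
  -- For fixed `s` each deficit averages to `κ` over `u`; two deficits with weight 18 account for
  -- the `36κ` in the hypothesis.
  have hd : ∀ s, 𝔼 u, (1 + κ - 𝔼 x, a (u + s + ι x)) = κ := by
    intro s
    rw [Finset.expect_sub_distrib, Fintype.expect_const,
      expect_add_right (fun u => 𝔼 x, a (u + ι x)) s, hshift, ha]
    ring
  have hd0 : 𝔼 u, (1 + κ - 𝔼 x, a (u + ι x)) = κ := by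
    have := hd 0
    simpa using this
  have hT : 𝔼 s, 𝔼 u, ν s * (𝔼 y, 𝔼 x, a (u + ι y) * a (u + s + ι x) * g (s + ι (x - y))) =
      𝔼 y, 𝔼 x, a y * a x * (ν (x - y) * g (x - y)) := by
    have hbase : 𝔼 y, 𝔼 x, a y * a x * (ν (x - y) * g (x - y)) =
        𝔼 s, 𝔼 u, a u * a (u + s) * (ν s * g s) := by
      conv_rhs => rw [Finset.expect_comm]
      refine Finset.expect_congr rfl fun u _ => ?_
      rw [← expect_add_right (fun x => a u * a x * (ν (x - u) * g (x - u))) u]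
      refine Finset.expect_congr rfl fun s _ => ?_
      rw [add_sub_cancel_right, add_comm s u]
    rw [hbase]
    simp_rw [Finset.mul_expect]
    calc 𝔼 s, 𝔼 u, 𝔼 y, 𝔼 x, ν s * (a (u + ι y) * a (u + s + ι x) * g (s + ι (x - y)))
        = 𝔼 y, 𝔼 x, 𝔼 s, 𝔼 u, ν s * (a (u + ι y) * a (u + s + ι x) * g (s + ι (x - y))) := by
          have h1 : ∀ s, 𝔼 u, 𝔼 y, 𝔼 x,
              ν s * (a (u + ι y) * a (u + s + ι x) * g (s + ι (x - y))) =
              𝔼 y, 𝔼 x, 𝔼 u, ν s * (a (u + ι y) * a (u + s + ι x) * g (s + ι (x - y))) := by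
            intro s
            rw [Finset.expect_comm]
            exact Finset.expect_congr rfl fun y _ => Finset.expect_comm _ _ _
          simp_rw [h1]
          rw [Finset.expect_comm]
          exact Finset.expect_congr rfl fun y _ => Finset.expect_comm _ _ _
      _ = 𝔼 y : D, 𝔼 x : D, 𝔼 s, 𝔼 u, a u * a (u + s) * (ν s * g s) := by
          refine Finset.expect_congr rfl fun y _ => Finset.expect_congr rfl fun x _ => ?_
          rw [← expect_add_right (fun s => 𝔼 u, a u * a (u + s) * (ν s * g s)) (ι (x - y))]
          refine Finset.expect_congr rfl fun s _ => ?_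
          rw [← expect_add_right (fun u => a u * a (u + (s + ι (x - y))) *
            (ν (s + ι (x - y)) * g (s + ι (x - y)))) (ι y)]
          refine Finset.expect_congr rfl fun u _ => ?_
          rw [hνι, show u + ι y + (s + ι (x - y)) = u + s + ι x by rw [map_sub]; abel]
          ring
      _ = _ := by rw [Fintype.expect_const, Fintype.expect_const]
  -- Everything is now an average over pairs of cosets, so one pair must have a positive term, and
  -- `ν s ≥ 0` can be dropped.
  have hpos : 0 < 𝔼 s, 𝔼 u, ν s * ((𝔼 y, 𝔼 x, a (u + ι y) * a (u + s + ι x) * g (s + ι (x - y))) -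
      (𝔼 x, g (s + ι x)) - (c + 18 * ((1 + κ - 𝔼 x, a (u + s + ι x)) +
        (1 + κ - 𝔼 x, a (u + ι x)))) * N s) := by
    have hsplit : 𝔼 s, 𝔼 u, ν s *
        ((𝔼 y, 𝔼 x, a (u + ι y) * a (u + s + ι x) * g (s + ι (x - y))) -
          (𝔼 x, g (s + ι x)) - (c + 18 * ((1 + κ - 𝔼 x, a (u + s + ι x)) +
          (1 + κ - 𝔼 x, a (u + ι x)))) * N s) =
        (𝔼 y, 𝔼 x, a y * a x * (ν (x - y) * g (x - y))) - (𝔼 x, ν x * g x) -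
          (c + 36 * κ) * 𝔼 s, ν s * N s := by
      rw [← hT, ← hM, Finset.mul_expect, ← Finset.expect_sub_distrib, ← Finset.expect_sub_distrib]
      refine Finset.expect_congr rfl fun s _ => ?_
      rw [← Finset.mul_expect, ← Finset.mul_expect, Finset.expect_sub_distrib,
        Finset.expect_sub_distrib, Fintype.expect_const, ← Finset.expect_mul,
        Finset.expect_add_distrib, ← Finset.mul_expect, Finset.expect_add_distrib, hd, hd0,
        Fintype.expect_const]
      ring
    rw [hsplit]
    have : (c + 36 * κ) * 𝔼 s, ν s * N s ≤ (c + 36 * κ) * E := by gcongr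
    linarith
  obtain ⟨s, -, hs⟩ := Finset.exists_lt_of_lt_expect univ_nonempty hpos
  obtain ⟨u, -, hu⟩ := Finset.exists_lt_of_lt_expect univ_nonempty hs
  refine ⟨s, u, N s, hN0 s, (hNp s).ge, ?_⟩
  have := pos_of_mul_pos_right hu (hν0 s)
  linarith

/-- Power means: the energy bound at exponent `2m` descends to every smaller `2k`, in particular to
one with `k` independent of `m`. -/
lemma expect_pow_le_of_le {G : Type*} [Fintype G] [Nonempty G] {F : G → ℝ} (hF : ∀ x, 0 ≤ F x)
    {B : ℝ} (hB : 0 ≤ B) {k m : ℕ} (hk : 1 ≤ k) (hkm : k ≤ m)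
    (h : 𝔼 x, F x ^ (2 * m) ≤ B ^ (2 * m)) : 𝔼 x, F x ^ (2 * k) ≤ B ^ (2 * k) := by
  have hk0 : (0 : ℝ) < k := by exact_mod_cast hk
  have hm0 : (0 : ℝ) < m := by exact_mod_cast hk.trans hkm
  have hc : (0 : ℝ) < Fintype.card G := by exact_mod_cast Fintype.card_pos
  have key := Real.arith_mean_le_rpow_mean univ (fun _ : G => 1 / (Fintype.card G : ℝ))
    (fun x => F x ^ (2 * k)) (fun _ _ => by positivity) (by simp [hc.ne'])
    (fun x _ => pow_nonneg (hF x) _) (p := (m : ℝ) / k)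
    (by rw [le_div_iff₀ hk0, one_mul]; exact_mod_cast hkm)
  have e1 : ∀ f : G → ℝ, ∑ x, 1 / (Fintype.card G : ℝ) * f x = 𝔼 x, f x := by
    intro f
    rw [Fintype.expect_eq_sum_div_card, Finset.sum_div]
    exact Finset.sum_congr rfl fun x _ => by ring
  have e2 : ∀ y : ℝ, 0 ≤ y → (y ^ (2 * k)) ^ ((m : ℝ) / k) = y ^ (2 * m) := by
    intro y hy
    rw [← Real.rpow_natCast y (2 * k), ← Real.rpow_mul hy, ← Real.rpow_natCast y (2 * m)]
    congr 1
    push_cast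
    field_simp
  rw [e1, e1] at key
  simp only [e2 _ (hF _)] at key
  refine key.trans ?_
  calc (𝔼 x, F x ^ (2 * m)) ^ (1 / ((m : ℝ) / k)) ≤ (B ^ (2 * m)) ^ (1 / ((m : ℝ) / k)) := by
        refine Real.rpow_le_rpow (expect_nonneg fun x _ => pow_nonneg (hF x) _) h (by positivity)
    _ = B ^ (2 * k) := by
        rw [← e2 B hB, ← Real.rpow_mul (by positivity), mul_one_div_cancel (by positivity),
          Real.rpow_one]

end SpectralBoosting

/-! ### Size bounds, choice of exponent, and the final argument. -/

namespace SpectralBoosting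

open Finset
open scoped ComplexConjugate

variable {p : ℕ} [Fact p.Prime] {n : ℕ}

/-- An exponent comparable to `log (2 / t)` whose power of two dominates `(2 / t) ^ 3`. -/
lemma exists_pow_two_ge {t : ℝ} (ht0 : 0 < t) (ht1 : t ≤ 1) :
    ∃ k : ℕ, 1 ≤ k ∧ (k : ℝ) ≤ 6 * Real.log (2 / t) + 1 ∧
      (∀ m : ℕ, 6 * Real.log (2 / t) ≤ m → k ≤ m) ∧ (2 / t) ^ 3 ≤ 2 ^ k := by
  set ℓ := Real.log (2 / t) with hℓ
  have h2 : 2 ≤ 2 / t := by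
    rw [le_div_iff₀ ht0]; linarith
  have hℓ0 : 1 / 2 < ℓ := by
    calc (1 / 2 : ℝ) < Real.log 2 := by linarith [Real.log_two_gt_d9]
      _ ≤ ℓ := Real.log_le_log (by norm_num) h2
  have hk1 : 6 * ℓ ≤ ⌈6 * ℓ⌉₊ := Nat.le_ceil _
  refine ⟨⌈6 * ℓ⌉₊, Nat.one_le_ceil_iff.2 (by linarith),
    (Nat.ceil_lt_add_one (by linarith)).le, fun m hm => Nat.ceil_le.2 hm, ?_⟩
  have h1 : (2 / t) ^ 3 = Real.exp (3 * ℓ) := by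
    rw [show 3 * ℓ = ((3 : ℕ) : ℝ) * ℓ by norm_num, Real.exp_nat_mul, hℓ,
      Real.exp_log (by positivity)]
  have hhalf : Real.exp (1 / 2) ≤ 2 := by
    refine le_of_pow_le_pow_left₀ (n := 2) (by norm_num) (by norm_num) ?_
    rw [← Real.exp_nat_mul]
    norm_num
    linarith [Real.exp_one_lt_d9]
  rw [h1]
  calc Real.exp (3 * ℓ) ≤ Real.exp (⌈6 * ℓ⌉₊ * (1 / 2)) := Real.exp_le_exp.2 (by linarith)
    _ = Real.exp (1 / 2) ^ ⌈6 * ℓ⌉₊ := Real.exp_nat_mul _ _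
    _ ≤ 2 ^ ⌈6 * ℓ⌉₊ := by gcongr

lemma card_le_of_le_shiftCount {X H : Finset (Fin n → ZMod p)} {K : ℝ} (hK0 : 0 < K)
    (hX0 : X.Nonempty) (hH : H.Nonempty)
    (hcount : K⁻¹ * #X * (#H : ℝ) ^ 2 ≤ shiftCount H X) : (#H : ℝ) ≤ K * #X := by
  have hx : (0 : ℝ) < #X := by exact_mod_cast hX0.card_pos
  have hh : (0 : ℝ) < #H := by exact_mod_cast hH.card_pos
  have h1 := hcount.trans (shiftCount_le H X)
  have h3 : K⁻¹ * #H * (#X * #H) ≤ #X * (#X * #H) := by nlinarith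
  have h4 := le_of_mul_le_mul_right h3 (by positivity)
  rwa [inv_mul_le_iff₀ hK0] at h4

/-- Here `h ≤ Kx ≤ Kα⁻¹η⁻² ≤ α⁻¹η⁻³`. A polynomial bound on `|H|` in `1/(αη)` suffices, since only
`|H| ≤ 2 ^ k` is needed. -/
lemma card_le_two_div_pow {x h α η K : ℝ} (hα0 : 0 < α) (hα1 : α ≤ 1) (hη0 : 0 < η)
    (hK0 : 0 < K) (hKη : K * η ≤ 1) (hXα : x * η ^ 2 ≤ α⁻¹) (hHX : h ≤ K * x)
    (hh : 0 ≤ h) : h ≤ (2 / (α * η)) ^ 3 := by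
  have h3 : h * (α * η ^ 3) ≤ 1 := by
    calc h * (α * η ^ 3) ≤ K * x * (α * η ^ 3) := by gcongr
      _ = (K * η) * (x * η ^ 2 * α) := by ring
      _ ≤ (K * η) * (α⁻¹ * α) := by gcongr
      _ ≤ 1 := by rwa [inv_mul_cancel₀ hα0.ne', mul_one]
  rw [div_pow, le_div_iff₀ (by positivity)]
  have h4 : (α * η) ^ 3 ≤ α * η ^ 3 := by
    rw [mul_pow]
    gcongr
    calc α ^ 3 ≤ α ^ 1 := pow_le_pow_of_le_one hα0.le hα1 (by norm_num)
      _ = α := pow_one α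
  calc h * (α * η) ^ 3 ≤ h * (α * η ^ 3) := by gcongr
    _ ≤ 2 ^ 3 := by linarith

lemma log_two_div_le {α η K : ℝ} (hα0 : 0 < α) (hα1 : α ≤ 1) (hη0 : 0 < η) (hK0 : 0 < K)
    (h : α ≤ 2 * K ^ 4 * η) : Real.log (2 / (α * η)) ≤ 4 * Real.log (4 / (α / K)) := by
  rw [show 4 * Real.log (4 / (α / K)) = ((4 : ℕ) : ℝ) * Real.log (4 / (α / K)) by norm_num,
    ← Real.log_pow]
  refine Real.log_le_log (by positivity) ?_
  have e : (4 / (α / K)) ^ 4 = 256 * K ^ 4 / α ^ 4 := by field_simp; norm_num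
  rw [e, div_le_div_iff₀ (by positivity) (by positivity)]
  have h6 : α ^ 4 ≤ α ^ 2 := pow_le_pow_of_le_one hα0.le hα1 (by norm_num)
  have h7 : 0 < K ^ 4 * (α * η) := by positivity
  calc 2 * α ^ 4 ≤ 2 * α ^ 2 := by gcongr
    _ = 2 * α * α := by ring
    _ ≤ 2 * α * (2 * K ^ 4 * η) := by gcongr
    _ = 4 * (K ^ 4 * (α * η)) := by ring
    _ ≤ 256 * (K ^ 4 * (α * η)) := by gcongr; norm_num
    _ = 256 * K ^ 4 * (α * η) := by ring

/-- The weight is at most `|H| ≤ 2 ^ k`, so it costs a factor `√2` in the `L^{2k}` norm. -/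
lemma expect_expWeight_mul_pow_le {X H : Finset (Fin n → ZMod p)} {b : ℝ} {k m : ℕ}
    (hb : 0 ≤ b) (hk1 : 1 ≤ k) (hkm : k ≤ m) (hHk : (#H : ℝ) ≤ 2 ^ k)
    (hE : (energy m X : ℝ) ≤ b ^ (2 * m)) :
    𝔼 x, expWeight H x * ‖expSum X x‖ ^ (2 * k) ≤ 2 ^ k * b ^ (2 * k) := by
  have hmom : 𝔼 x, ‖expSum X x‖ ^ (2 * k) ≤ b ^ (2 * k) :=
    expect_pow_le_of_le (fun x => norm_nonneg _) hb hk1 hkm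
      (by rw [expect_norm_expSum_pow]; exact hE)
  calc _ ≤ 𝔼 x, 2 ^ k * ‖expSum X x‖ ^ (2 * k) :=
        expect_le_expect fun x _ => mul_le_mul_of_nonneg_right
          ((expWeight_le H x).trans hHk) (by positivity)
    _ ≤ _ := by rw [← Finset.mul_expect]; gcongr

/-- The left side is the second moment of `|expSum X|` for the probability weight `expWeight H`, and
is controlled by the `2k`-th moment. -/
lemma shiftCount_div_card_le {X H : Finset (Fin n → ZMod p)} {b : ℝ} {k : ℕ}
    (hH : H.Nonempty) (hk1 : 1 ≤ k)
    (h : 𝔼 x, expWeight H x * ‖expSum X x‖ ^ (2 * k) ≤ 2 ^ k * b ^ (2 * k)) :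
    shiftCount H X / #H ≤ 2 * b ^ 2 := by
  rw [← expect_expWeight_mul_norm_sq]
  refine le_of_pow_le_pow_left₀ (n := k) (by omega) (by positivity) ?_
  have h1 := pow_expect_mul_le_of_nonneg (expWeight H) (fun x => ‖expSum X x‖ ^ 2)
    (expWeight_nonneg H) (fun x => by positivity) hk1
  rw [expect_expWeight hH, one_pow, one_mul] at h1
  simp only [← pow_mul] at h1
  refine h1.trans (h.trans (le_of_eq ?_))
  rw [mul_pow (2 : ℝ), ← pow_mul]

/-- Size bounds following from the energy and correlation hypotheses. -/
lemma exists_exponent {X H : Finset (Fin n → ZMod p)} {α η K : ℝ} {m : ℕ}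
    {a : (Fin n → ZMod p) → ℝ} (hα0 : 0 < α) (hα1 : α ≤ 1) (hη0 : 0 < η) (hK : 2 ≤ K)
    (hηK : η ≤ 1 / (4 * K ^ 5)) (hX0 : X.Nonempty) (hH : H.Nonempty)
    (ha2 : 𝔼 x, a x ^ 2 = α⁻¹) (hXa : ∀ γ ∈ X, η ≤ ‖coeff a (chi γ)‖)
    (hm : 6 * Real.log (2 / (α * η)) ≤ m) (hH1 : K⁻¹ * η⁻¹ ≤ #H)
    (hE : (energy m X : ℝ) ≤ (K * η * #X) ^ (2 * m))
    (hcount : K⁻¹ * #X * (#H : ℝ) ^ 2 ≤ shiftCount H X) :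
    ∃ k : ℕ, 1 ≤ k ∧ (k : ℝ) ≤ 25 * Real.log (4 / (α / K)) ∧ α⁻¹ ≤ 2 ^ (2 * k) ∧
      𝔼 x, expWeight H x * (expSum X x).re ^ (2 * k) ≤ (2 * (K * η * #X)) ^ (2 * k) ∧
      (#H : ℝ) ≤ K⁻¹ ^ 2 * η * #X / 2 := by
  have hK0 : 0 < K := by linarith
  have hx : (0 : ℝ) < #X := by exact_mod_cast hX0.card_pos
  have hh : (0 : ℝ) < #H := by exact_mod_cast hH.card_pos
  have hη4 : 4 * K ^ 5 * η ≤ 1 := by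
    rw [le_div_iff₀ (by positivity)] at hηK; linarith
  have hKη : K * η ≤ 1 := by
    have h1 : K ≤ K ^ 5 := le_self_pow₀ (by linarith) (by norm_num)
    have h2 : K * η ≤ K ^ 5 * η := by gcongr
    have h3 : 0 ≤ K ^ 5 * η := by positivity
    linarith
  have hη1 : η ≤ 1 := (le_mul_of_one_le_left hη0.le (by linarith)).trans hKη
  have hαη : 0 < α * η := by positivity
  have hαη1 : α * η ≤ 1 := mul_le_one₀ hα1 hη0.le hη1
  obtain ⟨k, hk1, hk2, hkm, hcube⟩ := exists_pow_two_ge hαη hαη1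
  have hXα : #X * η ^ 2 ≤ α⁻¹ := (card_mul_sq_le_expect_sq hη0.le hXa).trans ha2.le
  have hHk : (#H : ℝ) ≤ 2 ^ k := (card_le_two_div_pow hα0 hα1 hη0 hK0 hKη hXα
    (card_le_of_le_shiftCount hK0 hX0 hH hcount) hh.le).trans hcube
  have hwmom := expect_expWeight_mul_pow_le (by positivity) hk1 (hkm m hm) hHk hE
  -- Hypothesis 3 against the second-moment bound gains a factor `η²` over the trivial `|H| ≤ K|X|`.
  have hHη : (#H : ℝ) ≤ 2 * K ^ 3 * η ^ 2 * #X := by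
    have h3 : K⁻¹ * #X * #H ≤ 2 * (K * η * #X) ^ 2 := by
      refine le_trans ?_ (shiftCount_div_card_le hH hk1 hwmom)
      rw [le_div_iff₀ hh]
      linarith
    have h4 : #H * (K⁻¹ * #X) ≤ 2 * K ^ 3 * η ^ 2 * #X * (K⁻¹ * #X) := by
      calc #H * (K⁻¹ * #X) = K⁻¹ * #X * #H := by ring
        _ ≤ 2 * (K * η * #X) ^ 2 := h3
        _ = _ := by field_simp
    exact le_of_mul_le_mul_right h4 (by positivity)
  refine ⟨k, hk1, ?_, ?_, ?_, ?_⟩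
  -- Parseval and hypothesis 1 force `η ≥ α/(2K⁴)`, so `log(2/(αη))` is at most a multiple of
  -- `log(4K/α)`, and `k` no longer depends on `η`.
  · have h3 : K⁻¹ * η⁻¹ ≤ 2 * K ^ 3 * α⁻¹ := by
      calc K⁻¹ * η⁻¹ ≤ #H := hH1
        _ ≤ 2 * K ^ 3 * η ^ 2 * #X := hHη
        _ = 2 * K ^ 3 * (#X * η ^ 2) := by ring
        _ ≤ _ := by gcongr
    have h5 : α ≤ 2 * K ^ 4 * η := by
      calc α = K⁻¹ * η⁻¹ * (K * η * α) := by field_simp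
        _ ≤ 2 * K ^ 3 * α⁻¹ * (K * η * α) := by gcongr
        _ = _ := by field_simp
    have hL2 := two_le_log_four_div hα0 hα1 hK
    have hℓL := log_two_div_le hα0 hα1 hη0 hK0 h5
    linarith
  · have h3 : α⁻¹ ≤ 2 / (α * η) := by
      rw [inv_eq_one_div, div_le_div_iff₀ hα0 hαη, one_mul]
      have h4 : α * η ≤ α * 1 := by gcongr
      linarith
    have h5 : 1 ≤ 2 / (α * η) := by
      rw [le_div_iff₀ hαη]; linarith
    exact (h3.trans (le_self_pow₀ h5 (by norm_num))).trans
      (hcube.trans (pow_le_pow_right₀ (by norm_num) (by omega)))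
  · calc 𝔼 x, expWeight H x * (expSum X x).re ^ (2 * k)
        ≤ 𝔼 x, expWeight H x * ‖expSum X x‖ ^ (2 * k) := by
          refine expect_le_expect fun x _ => mul_le_mul_of_nonneg_left ?_ (expWeight_nonneg H x)
          rw [← (even_two_mul k).pow_abs]
          gcongr
          exact Complex.abs_re_le_norm _
      _ ≤ 2 ^ k * (K * η * #X) ^ (2 * k) := hwmom
      _ ≤ 2 ^ (2 * k) * (K * η * #X) ^ (2 * k) := by
          gcongr
          · norm_num
          · omega
      _ = _ := by rw [← mul_pow]
  · calc (#H : ℝ) ≤ 2 * K ^ 3 * η ^ 2 * #X := hHη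
      _ = (4 * K ^ 5 * η) * (K⁻¹ ^ 2 * η * #X / 2) := by field_simp; norm_num
      _ ≤ 1 * (K⁻¹ ^ 2 * η * #X / 2) := by gcongr
      _ = _ := one_mul _

lemma expect_mu {A : Finset (Fin n → ZMod p)} (hA : A.Nonempty) :
    𝔼 x, mu (A : Set (Fin n → ZMod p)) x = 1 := by
  have h1 : (0 : ℝ) < #A := by exact_mod_cast hA.card_pos
  have h2 : (0 : ℝ) < Fintype.card (Fin n → ZMod p) := by exact_mod_cast Fintype.card_pos
  simp only [mu]
  rw [← Finset.mul_expect, expect_ind, density_coe, inv_mul_cancel₀ (by positivity)]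

lemma expect_mu_sq {A : Finset (Fin n → ZMod p)} (hA : A.Nonempty) :
    𝔼 x, mu (A : Set (Fin n → ZMod p)) x ^ 2 = (density (A : Set (Fin n → ZMod p)))⁻¹ := by
  classical
  have h : ∀ x, mu (A : Set (Fin n → ZMod p)) x ^ 2 =
      (density (A : Set (Fin n → ZMod p)))⁻¹ * mu (A : Set (Fin n → ZMod p)) x := by
    intro x
    simp only [mu, ind_coe_eq_ite]
    split_ifs <;> ring
  simp_rw [h]
  rw [← Finset.mul_expect, expect_mu hA, mul_one]

lemma density_pos {A : Finset (Fin n → ZMod p)} (hA : A.Nonempty) :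
    0 < density (A : Set (Fin n → ZMod p)) := by
  rw [density_coe]
  have : 0 < #A := hA.card_pos
  have : 0 < Fintype.card (Fin n → ZMod p) := Fintype.card_pos
  positivity

lemma density_le_one (A : Finset (Fin n → ZMod p)) :
    density (A : Set (Fin n → ZMod p)) ≤ 1 := by
  rw [density_coe]
  exact div_le_one_of_le₀ (by exact_mod_cast Finset.card_le_univ A) (by positivity)

/-- The spectral boosting argument when `η` is small in terms of `K`. -/
lemma exists_subspace_increment_of_small {A X H : Finset (Fin n → ZMod p)} {α η K : ℝ} {m : ℕ}
    (hA : A.Nonempty) (hα : α = density (A : Set (Fin n → ZMod p))) (hη0 : 0 < η) (hK : 2 ≤ K)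
    (hηK : η ≤ 1 / (4 * K ^ 5)) (hX0 : X.Nonempty)
    (hXa : ∀ γ ∈ X, η ≤ ‖coeff (mu (A : Set (Fin n → ZMod p))) (chi γ)‖)
    (hm : 6 * Real.log (2 / (α * η)) ≤ m) (hH1 : K⁻¹ * η⁻¹ ≤ #H)
    (hE : (energy m X : ℝ) ≤ (K * η * #X) ^ (2 * m))
    (hcount : K⁻¹ * #X * (#H : ℝ) ^ 2 ≤ shiftCount H X) :
    ∃ W : Submodule (ZMod p) (Fin n → ZMod p),
      (Module.finrank (ZMod p) ((Fin n → ZMod p) ⧸ W) : ℝ) ≤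
        linDim H + 10 ^ 14 * Real.log (4 / (α / K)) ^ 5 * K ^ 6 ∧
      ∃ x, 1 + K⁻¹ ^ 13 < finAvg (elems W) (mu (A : Set (Fin n → ZMod p))) x := by
  classical
  have hα0 : 0 < α := hα ▸ density_pos hA
  have hα1 : α ≤ 1 := hα ▸ density_le_one A
  have hK0 : 0 < K := by linarith
  have hx : (0 : ℝ) < #X := by exact_mod_cast hX0.card_pos
  have hH : H.Nonempty := by
    rw [← card_pos]
    have : (0 : ℝ) < #H := lt_of_lt_of_le (by positivity) hH1
    exact_mod_cast this
  have hh : (0 : ℝ) < #H := by exact_mod_cast hH.card_pos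
  set a := mu (A : Set (Fin n → ZMod p)) with ha
  have haeq : ∀ x, a x = α⁻¹ * ind (A : Set (Fin n → ZMod p)) x := fun x => by rw [hα]; rfl
  obtain ⟨k, hk1, hkL, hαk, hmom, hHX⟩ := exists_exponent hα0 hα1 hη0 hK hηK hX0 hH
    ((expect_mu_sq hA).trans (by rw [hα])) hXa hm hH1 hE hcount
  -- `K ≥ 2` gives `K⁻¹⁰ ≤ 1/1024`, so `κ` is `K⁻³` times a small constant and `c + 36κ ≤ K⁻³/8`.
  set κ : ℝ := K⁻¹ ^ 13 with hκ
  set c : ℝ := K⁻¹ ^ 3 / 16 with hc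
  have hKi : 0 < K⁻¹ := inv_pos.2 hK0
  have hKi2 : K⁻¹ ≤ 1 / 2 := by
    rw [inv_eq_one_div]; exact one_div_le_one_div_of_le (by norm_num) hK
  have hκ0 : 0 < κ := by positivity
  have hκ3 : κ ≤ K⁻¹ ^ 3 / 1024 := by
    calc κ = K⁻¹ ^ 3 * K⁻¹ ^ 10 := by rw [hκ]; ring
      _ ≤ K⁻¹ ^ 3 * (1 / 2) ^ 10 := by gcongr
      _ = _ := by norm_num; ring
  have hKi3 : K⁻¹ ^ 3 ≤ 1 := pow_le_one₀ hKi.le (by linarith)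
  have hKi3' : 0 < K⁻¹ ^ 3 := by positivity
  obtain ⟨d, ι, hι, hrange⟩ := exists_linear_parametrization (perp H)
  -- The pairing is at least `K⁻²η|X|`; the main term takes at most half of this and the norm term
  -- at most a quarter.
  have hcorr : 𝔼 x, expWeight H x * (expSum X x).re + (c + 36 * κ) * (2 * (K * η * #X)) <
      𝔼 y, 𝔼 x, a y * a x * (expWeight H (x - y) * (expSum X (x - y)).re) := by
    have h1 := expect_expWeight_mul_re_expSum_le hH X
    have h2 := le_expect_expect_mul_expWeight hη0.le hXa (H := H)
    have h3 : K⁻¹ ^ 2 * η * #X ≤ η ^ 2 * (shiftCount H X / #H) := by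
      calc K⁻¹ ^ 2 * η * #X = η ^ 2 * (K⁻¹ * #X * (K⁻¹ * η⁻¹)) := by field_simp
        _ ≤ η ^ 2 * (K⁻¹ * #X * #H) := by gcongr
        _ ≤ _ := by
            gcongr
            rw [le_div_iff₀ hh]
            linarith
    have h4 : (c + 36 * κ) * (2 * (K * η * #X)) ≤ K⁻¹ ^ 3 / 8 * (2 * (K * η * #X)) := by
      gcongr
      rw [hc]; linarith
    have h5 : K⁻¹ ^ 3 / 8 * (2 * (K * η * #X)) = K⁻¹ ^ 2 * η * #X / 4 := by
      field_simp; norm_num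
    have h6 : 0 < K⁻¹ ^ 2 * η * #X := by positivity
    linarith
  obtain ⟨s, u, N, hN0, hNg, hsu⟩ := exists_correlated_cosets ι.toAddMonoidHom hk1 (expect_mu hA)
    (expWeight_nonneg H) (expect_expWeight hH)
    (fun x z => expWeight_add_of_mem_perp (by rw [← hrange]; exact LinearMap.mem_range_self ι z) x)
    (by positivity) hκ0.le (by positivity) hmom hcorr
  simp only [LinearMap.toAddMonoidHom_coe] at hNg hsu
  have hperpdim := finrank_quotient_perp_le_linDim H
  have hL2 := two_le_log_four_div hα0 hα1 hK
  -- Either `perp H` already works, or no coset of it is too dense and both pieces of `A` satisfy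
  -- the upper bound `1 + κ`.
  by_cases hbig : ∃ x, 1 + κ < finAvg (elems (perp H)) a x
  · refine ⟨perp H, ?_, hbig⟩
    have : (Module.finrank (ZMod p) ((Fin n → ZMod p) ⧸ perp H) : ℝ) ≤ linDim H := by
      exact_mod_cast hperpdim
    have : 0 ≤ 10 ^ 14 * Real.log (4 / (α / K)) ^ 5 * K ^ 6 := by positivity
    linarith
  push Not at hbig
  have hcoset : ∀ v, 𝔼 x, a (v + ι x) ≤ 1 + κ := fun v => by
    rw [expect_map_eq_finAvg ι hι a v, hrange]; exact hbig v
  obtain ⟨q, l, δ, hq, hδ, hδq, herr, hdim⟩ := exists_parameters hα0 hα1 hK hkL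
  let B : (Fin n → ZMod p) → Finset (Fin d → ZMod p) := fun v => univ.filter fun x => v + ι x ∈ A
  have hB : ∀ v x, α⁻¹ * ind (B v : Set (Fin d → ZMod p)) x = a (v + ι x) := fun v x => by
    rw [haeq, ind_coe_eq_ite, ind_coe_eq_ite]; simp [B]
  have hBm : ∀ v, α⁻¹ * 𝔼 x, ind (B v : Set (Fin d → ZMod p)) x = 𝔼 x, a (v + ι x) := fun v => by
    rw [Finset.mul_expect]; simp_rw [hB]
  obtain ⟨V, hVdim, y, hy⟩ := exists_increment_of_correlation hα0 hα1 hκ0.le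
    (show κ ≤ 1 by linarith) (show 3 * κ ≤ c / 2 by rw [hc]; linarith) (B (u + s)) (B u)
    (fun x => (expSum X (s + ι x)).re) (by rw [hBm]; exact hcoset _) (by rw [hBm]; exact hcoset _)
    hk1 hαk hN0 hNg hq hδ hδq herr (by simp_rw [hBm, hB]; exact hsu)
  refine ⟨V.map ι, ?_, ?_⟩
  · rw [finrank_quotient_map ι hι V, hrange]
    push_cast
    have : (Module.finrank (ZMod p) ((Fin n → ZMod p) ⧸ perp H) : ℝ) ≤ linDim H := by
      exact_mod_cast hperpdim
    linarith
  · simp_rw [hB, finAvg_map ι hι V a] at hy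
    rcases hy with hy | hy
    · exact ⟨_, hy⟩
    · exact ⟨_, hy⟩

end SpectralBoosting

/-! ### Assembly: small and large `η`. -/

theorem mainTheorem10 :
    ∃ C C₁ C₂ C₃ C₄ : ℝ, 0 < C ∧ 0 < C₁ ∧ 0 < C₂ ∧ 0 < C₃ ∧ 0 < C₄ ∧
      ∀ (p : ℕ) [Fact p.Prime] (n : ℕ) (A : Finset (Fin n → ZMod p)) (α η K : ℝ) (m : ℕ)
        (X H : Finset (Fin n → ZMod p)),
        A.Nonempty →
        α = SpectralBoosting.density (A : Set (Fin n → ZMod p)) →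
        0 < η → η ≤ 1 →
        C * Real.log (2 / (α * η)) ≤ (m : ℝ) →
        2 ≤ K →
        X.Nonempty →
        (X : Set (Fin n → ZMod p)) ⊆
          SpectralBoosting.largeSpectrum η
            (SpectralBoosting.ind (A : Set (Fin n → ZMod p))) \ {0} →
        K⁻¹ * η⁻¹ ≤ (H.card : ℝ) →
        (SpectralBoosting.energy m X : ℝ) ≤ (K * η * (X.card : ℝ)) ^ (2 * m) →
        K⁻¹ * (X.card : ℝ) * (H.card : ℝ) ^ 2 ≤
          SpectralBoosting.dualInner
            (SpectralBoosting.dualCirc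
              (SpectralBoosting.ind (X : Set (Fin n → ZMod p)))
              (SpectralBoosting.ind (X : Set (Fin n → ZMod p))))
            (SpectralBoosting.dualCirc
              (SpectralBoosting.ind (H : Set (Fin n → ZMod p)))
              (SpectralBoosting.ind (H : Set (Fin n → ZMod p)))) →
        SpectralBoosting.lpNorm (2 * (m : ℝ))
          (SpectralBoosting.circ
            (SpectralBoosting.mu (A : Set (Fin n → ZMod p)))
            (SpectralBoosting.mu (A : Set (Fin n → ZMod p)))) ≤ K →
        ∃ W : Submodule (ZMod p) (Fin n → ZMod p),
          (Module.finrank (ZMod p) ((Fin n → ZMod p) ⧸ W) : ℝ) ≤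
            (SpectralBoosting.linDim H : ℝ) +
              C₁ * Real.log (4 / (α / K)) ^ C₂ * K ^ C₃ ∧
          1 + K ^ (-C₄) ≤
            SpectralBoosting.supNorm
              (SpectralBoosting.conv
                (SpectralBoosting.mu (A : Set (Fin n → ZMod p)))
                (SpectralBoosting.mu (W : Set (Fin n → ZMod p)))) := by
  refine ⟨6, 10 ^ 14, 5, 6, 13, by norm_num, by norm_num, by norm_num, by norm_num, by norm_num, ?_⟩
  intro p _ n A α η K m X H hA hα hη0 _ hm hK hX0 hXsub hH1 hE hcount _
  have hK0 : 0 < K := by linarith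
  have hα0 : 0 < α := hα ▸ SpectralBoosting.density_pos hA
  have hα1 : α ≤ 1 := hα ▸ SpectralBoosting.density_le_one A
  have hL2 := SpectralBoosting.two_le_log_four_div hα0 hα1 hK
  have e5 : Real.log (4 / (α / K)) ^ (5 : ℝ) = Real.log (4 / (α / K)) ^ 5 := by
    exact_mod_cast Real.rpow_natCast _ 5
  have e6 : K ^ (6 : ℝ) = K ^ 6 := by exact_mod_cast Real.rpow_natCast K 6
  have e13 : K ^ (-13 : ℝ) = K⁻¹ ^ 13 := by
    rw [Real.rpow_neg hK0.le, inv_pow]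
    congr 1
    exact_mod_cast Real.rpow_natCast K 13
  have hXa : ∀ γ ∈ X, η ≤ ‖SpectralBoosting.coeff
      (SpectralBoosting.mu (A : Set (Fin n → ZMod p))) (SpectralBoosting.chi γ)‖ :=
    fun γ hγ => SpectralBoosting.le_norm_coeff_of_mem_largeSpectrum hA (hXsub hγ).1
  rw [SpectralBoosting.dualInner_dualCirc_eq] at hcount
  simp_rw [e5, e6, e13, SpectralBoosting.conv_mu_submodule]
  -- Below the threshold `|H|` is small enough for the boosting argument. Above it a single
  -- frequency already gives `η/2 > 1/(8K⁵) ≥ K⁻¹³` at codimension at most 1.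
  rcases le_or_gt η (1 / (4 * K ^ 5)) with hηK | hηK
  · obtain ⟨W, hW, x, hx⟩ := SpectralBoosting.exists_subspace_increment_of_small hA hα hη0 hK hηK
      hX0 hXa hm hH1 hE hcount
    exact ⟨W, hW, hx.le.trans (SpectralBoosting.le_supNorm _ x)⟩
  · obtain ⟨γ, hγ⟩ := hX0
    have hγ0 : γ ≠ 0 := fun h => (hXsub hγ).2 h
    obtain ⟨x, hx⟩ := SpectralBoosting.exists_hyperplane_increment (SpectralBoosting.expect_mu hA)
      hγ0 hη0 (hXa γ hγ)
    refine ⟨SpectralBoosting.perp {γ}, ?_, le_trans ?_ (SpectralBoosting.le_supNorm _ x)⟩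
    · have h1 : (Module.finrank (ZMod p) ((Fin n → ZMod p) ⧸ SpectralBoosting.perp {γ}) : ℝ) ≤ 1 := by
        exact_mod_cast SpectralBoosting.finrank_quotient_perp_le {γ}
      have h2 : (1 : ℝ) ≤ Real.log (4 / (α / K)) ^ 5 := one_le_pow₀ (by linarith)
      have h3 : (1 : ℝ) ≤ K ^ 6 := one_le_pow₀ (by linarith)
      have h4 : (1 : ℝ) ≤ 10 ^ 14 * Real.log (4 / (α / K)) ^ 5 * K ^ 6 :=
        one_le_mul_of_one_le_of_one_le
          (one_le_mul_of_one_le_of_one_le (by norm_num) h2) h3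
      have h5 : (0 : ℝ) ≤ SpectralBoosting.linDim H := by positivity
      linarith
    · refine le_trans ?_ hx
      have h1 : K⁻¹ ^ 13 ≤ 1 / (8 * K ^ 5) := by
        rw [inv_pow, inv_eq_one_div]
        refine one_div_le_one_div_of_le (by positivity) ?_
        calc 8 * K ^ 5 ≤ K ^ 8 * K ^ 5 := by
              gcongr
              calc (8 : ℝ) ≤ 2 ^ 8 := by norm_num
                _ ≤ K ^ 8 := by gcongr
          _ = K ^ 13 := by ring
      have h2 : 1 / (8 * K ^ 5) = 1 / (4 * K ^ 5) / 2 := by field_simp; norm_num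
      linarith
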